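/- Let $q\ge 3$ and $t\ge 3$ be integers, and let $\mathcal Q=\mathbb Z/q\mathbb Z$. **Fingerprinting codes.** Write $[M]=\{1,\dots,M\}$. A two-level code $(C,D_1,D_2)$ of length $n$ for the users $\mathbf u=(u_1,u_2)\in[M_1]\times[M_2]$ ($u_1$ is the group of $\mathbf u$) consists of maps $C:[M_1]\times[M_2]\to\mathcal Q^n$, $D_1:\mathcal Q^n\to[M_1]\cup\{0\}$, $D_2:\mathcal Q^n\to([M_1]\times[M_2])\cup\{0\}$. A randomized code $(\mathcal C,\mathcal D_1,\mathcal D_2)$ is a finite family $(C_k,D_{1k},D_{2k})_k$ of such codes with a probability distribution $\pi$ on the keys $k$. A strategy $V$ of a coalition $U\subseteq[M_1]\times[M_2]$ is a family of probability distributions $V(\cdot\mid \mathbf x)$ on $\mathcal Q^n$, one for each tuple $\mathbf x=(\mathbf x_{\mathbf u})_{\mathbf u\in U}$ of words in $\mathcal Q^n$; it is admissible if $V(\mathbf y\mid\mathbf x)>0$ implies that for every coordinate $l$ there is $\mathbf u\in U$ with $y_l=x_{\mathbf u,l}$. The error probabilities are $$e_1(U,V)=\sum_k\pi(k)\sum_{\mathbf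 y:\,D_{1k}(\mathbf y)\notin\{u_1:\,\mathbf u\in U\}}V(\mathbf y\mid C_k(U)),\qquad e_2(U,V)=\sum_k\pi(k)\sum_{\mathbf y:\,D_{2k}(\mathbf y)\notin U}V(\mathbf y\mid C_k(U)),$$ where $C_k(U)=(C_k(\mathbf u))_{\mathbf u\in U}$. For $t_1>t_2$ the randomized code is $(t_1,t_2)$-fingerprinting with $\varepsilon$-error if $e_2(U,V)\le\varepsilon$ for all $U$ with $|U|\le t_2$ and all admissible $V$, and $e_1(U,V)\le\varepsilon$ for all $U$ with $|U|\le t_1$ and all admissible $V$. **The construction.** Let $\omega,R_1,R_2\in[0,1]$, let $n$ be such that $w=\omega n$ is an integer, and put $M_{in}=\lfloor q^{nR_i}\rfloor$. Choose vectors $\mathbf R_i$ ($i\in[M_{1n}]$) uniformly from $\mathcal Q^n$ and vectors $\mathbf S_{ij}$ ($(i,j)\in[M_{1n}]\times[M_{2n}]$) uniformly from the words of Hamming weight $w$ in $\mathcal Q^n$, all independently. User $(i,j)$ gets the fingerprint $\mathbf R_i+\mathbf S_{ij}$. The decoder $\mathcal D^\omega_{2n}$ outputs a user whose fingerprint has minimum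 Hamming distance to the given word (any one of them if there are several), and $\mathcal D^\omega_{1n}$ outputs the group of that user. Call this randomized code $(\mathcal C^\omega_n,\mathcal D^\omega_{1n},\mathcal D^\omega_{2n})$. **The exponents.** Let $h(x)=-x\log_q\frac{x}{q-1}-(1-x)\log_q(1-x)$ with $0\log_q 0=0$. For $\gamma,\alpha,\beta\in[0,1]$ with $\alpha\le1-\gamma$, $\beta\le\gamma$, $\alpha+\beta\le\omega$, $\omega-\alpha\le\gamma$ let $$\phi(\omega,\gamma,\alpha,\beta)=(1-\gamma)h\Big(\frac{\alpha}{1-\gamma}\Big)+(\gamma-\beta)h\Big(\frac{\omega-\alpha-\beta}{\gamma-\beta}\Big)+\gamma h\Big(\frac{\beta}{\gamma}\Big)+(\omega-\alpha)\log_q\frac{q-2}{q-1}-\beta\log_q(q-2),$$ where a term with factor $1-\gamma$, $\gamma-\beta$ or $\gamma$ equal to $0$ is read as $0$. Let $\delta_1(\omega)=\frac12\big(1-(1-\omega)^2-\frac{\omega^2}{q-1}\big)$ and $\delta_2=\frac12\big(1-\frac1q\big)$. Let $f_1(\omega)$ be the maximum of $\phi(\omega,\gamma,\alpha,\beta)$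 over all such $(\gamma,\alpha,\beta)$ with $\omega^2\le\gamma\le1-(1-\omega)^2$ and $\gamma-\beta+\alpha\le\delta_1(\omega)$, and $f_2(\omega)$ its maximum over all such $(\gamma,\alpha,\beta)$ with $\omega\frac{q-1}{q}\le\gamma\le1-\frac{1-\omega}{q}$ and $\gamma-\beta+\alpha\le\delta_2$. **Theorem.** Let $\omega\in[0,1]$ satisfy $\frac{t-1}{t}\big(1-\frac1{q^{t-1}}\big)+\omega\le\frac{q-1}{q}$, and let $R_1,R_2\in[0,1]$ satisfy $$R_1<1-h\Big(\frac{t-1}{t}\Big(1-\frac1{q^{t-1}}\Big)+\omega\Big),\qquad R_2<h(\omega)-\max\big(f_1(\omega),f_2(\omega)\big).$$ Then there is a sequence $\varepsilon_n\to0$ such that for every $n$ for which $\omega n$ is an integer, and however ties are broken in the decoder, the randomized code $(\mathcal C^\omega_n,\mathcal D^\omega_{1n},\mathcal D^\omega_{2n})$ is $(t,2)$-fingerprinting with $\varepsilon_n$-error. -/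

import Mathlib

open Filter Topology

namespace TwoLevel

/-! ### Entropy and the exponents -/

/-- The `q`-ary entropy `h(x) = - x log_q (x / (q-1)) - (1-x) log_q (1-x)`
(with `0 log 0 = 0`). -/
noncomputable def entropy (q : ℕ) (x : ℝ) : ℝ :=
  -x * Real.logb q (x / ((q : ℝ) - 1)) - (1 - x) * Real.logb q (1 - x)

/-- Comparison with Mathlib's `q`-ary entropy, which uses the natural logarithm. -/
theorem entropy_eq_qaryEntropy (q : ℕ) (hq : 2 ≤ q) (x : ℝ) :
    entropy q x = Real.qaryEntropy q x / Real.log q := by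
  have h1 : ((q : ℝ) - 1) ≠ 0 := by
    have : (2 : ℝ) ≤ q := by exact_mod_cast hq
    linarith
  have h2 : (((q : ℤ) - 1 : ℤ) : ℝ) = (q : ℝ) - 1 := by push_cast; ring
  unfold entropy Real.qaryEntropy Real.binEntropy Real.logb
  rw [h2, Real.log_inv, Real.log_inv]
  by_cases hx : x = 0
  · subst hx; simp
  · rw [Real.log_div hx h1]; ring

/-- The exponent `φ(ω, γ, α, β)`. -/
noncomputable def phi (q : ℕ) (ω γ α β : ℝ) : ℝ :=
  (1 - γ) * entropy q (α / (1 - γ))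
    + (γ - β) * entropy q ((ω - α - β) / (γ - β))
    + γ * entropy q (β / γ)
    + (ω - α) * Real.logb q (((q : ℝ) - 2) / ((q : ℝ) - 1))
    - β * Real.logb q ((q : ℝ) - 2)

/-- The domain of `φ(ω, ·, ·, ·)`. -/
def PhiDomain (ω γ α β : ℝ) : Prop :=
  γ ∈ Set.Icc (0 : ℝ) 1 ∧ α ∈ Set.Icc (0 : ℝ) 1 ∧ β ∈ Set.Icc (0 : ℝ) 1 ∧
    α ≤ 1 - γ ∧ β ≤ γ ∧ α + β ≤ ω ∧ ω - α ≤ γ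

noncomputable def delta1 (q : ℕ) (ω : ℝ) : ℝ :=
  (1 / 2) * (1 - (1 - ω) ^ 2 - ω ^ 2 / ((q : ℝ) - 1))

noncomputable def delta2 (q : ℕ) : ℝ :=
  (1 / 2) * (1 - 1 / (q : ℝ))

/-- `f₁(ω)`, the maximum of `φ(ω, γ, α, β)` over the points of the domain with
`ω² ≤ γ ≤ 1 - (1-ω)²` and `γ - β + α ≤ δ₁(ω)`. -/
noncomputable def f1 (q : ℕ) (ω : ℝ) : ℝ :=
  sSup {v : ℝ | ∃ γ α β : ℝ, PhiDomain ω γ α β ∧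
    ω ^ 2 ≤ γ ∧ γ ≤ 1 - (1 - ω) ^ 2 ∧ γ - β + α ≤ delta1 q ω ∧
    v = phi q ω γ α β}

/-- `f₂(ω)`, the maximum of `φ(ω, γ, α, β)` over the points of the domain with
`ω (q-1)/q ≤ γ ≤ 1 - (1-ω)/q` and `γ - β + α ≤ δ₂`. -/
noncomputable def f2 (q : ℕ) (ω : ℝ) : ℝ :=
  sSup {v : ℝ | ∃ γ α β : ℝ, PhiDomain ω γ α β ∧
    ω * (((q : ℝ) - 1) / q) ≤ γ ∧ γ ≤ 1 - (1 - ω) / q ∧ γ - β + α ≤ delta2 q ∧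
    v = phi q ω γ α β}

/-! ### Two-level codes and fingerprinting -/

/-- Words of length `n` over the alphabet `{0, …, q-1}` with addition modulo `q`. -/
abbrev Word (q n : ℕ) : Type := Fin n → ZMod q

/-- Users: pairs (group, index within the group). -/
abbrev User (M₁ M₂ : ℕ) : Type := Fin M₁ × Fin M₂

/-- An `(n, M₁, M₂)_q` two-level code; `none` signifies a decoding failure. -/
structure TwoLevelCode (q n M₁ M₂ : ℕ) where
  enc : User M₁ M₂ → Word q n
  dec₁ : Word q n → Option (Fin M₁)
  dec₂ : Word q n → Option (User M₁ M₂)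

/-- A randomized two-level code: a finite family of two-level codes together with a
probability distribution on the keys. -/
structure RandomizedCode (q n M₁ M₂ : ℕ) where
  Key : Type
  [fintypeKey : Fintype Key]
  prob : Key → ℝ
  prob_nonneg : ∀ k, 0 ≤ prob k
  prob_sum : ∑ k, prob k = 1
  code : Key → TwoLevelCode q n M₁ M₂

attribute [instance] RandomizedCode.fintypeKey

/-- The envelope of a family of words. -/
def envelope {q n : ℕ} {ι : Type} (x : ι → Word q n) : Set (Word q n) :=
  {y | ∀ l : Fin n, ∃ i : ι, y l = x i l}

/-- A (randomized) attack of the coalition `U`: `V.prob x y` is the probability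
`V(y | x)` of creating `y` when the members of `U` observe the fingerprints `x`. -/
structure Strategy (q n : ℕ) [NeZero q] {M₁ M₂ : ℕ} (U : Finset (User M₁ M₂)) where
  prob : (U → Word q n) → Word q n → ℝ
  prob_nonneg : ∀ x y, 0 ≤ prob x y
  prob_sum : ∀ x, ∑ y, prob x y = 1

/-- Admissible strategies only create forgeries inside the envelope. -/
def Strategy.Admissible {q n : ℕ} [NeZero q] {M₁ M₂ : ℕ} {U : Finset (User M₁ M₂)}
    (V : Strategy q n U) : Prop :=
  ∀ x y, y ∉ envelope x → V.prob x y = 0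

/-- The probability that the first decoder does not output the group of a pirate. -/
noncomputable def RandomizedCode.e₁ {q n : ℕ} [NeZero q] {M₁ M₂ : ℕ}
    (C : RandomizedCode q n M₁ M₂) (U : Finset (User M₁ M₂)) (V : Strategy q n U) : ℝ :=
  ∑ k, C.prob k *
    ∑ y with ∀ u ∈ U, (C.code k).dec₁ y ≠ some u.1,
      V.prob (fun u => (C.code k).enc u) y

/-- The probability that the second decoder does not output a pirate. -/
noncomputable def RandomizedCode.e₂ {q n : ℕ} [NeZero q] {M₁ M₂ : ℕ}
    (C : RandomizedCode q n M₁ M₂) (U : Finset (User M₁ M₂)) (V : Strategy q n U) : ℝ :=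
  ∑ k, C.prob k *
    ∑ y with ∀ u ∈ U, (C.code k).dec₂ y ≠ some u,
      V.prob (fun u => (C.code k).enc u) y

/-- `(t₁, t₂)`-fingerprinting with `ε`-error (a notion used for `t₁ > t₂`). -/
def RandomizedCode.IsFingerprinting {q n : ℕ} [NeZero q] {M₁ M₂ : ℕ}
    (C : RandomizedCode q n M₁ M₂) (t₁ t₂ : ℕ) (ε : ℝ) : Prop :=
  (∀ U : Finset (User M₁ M₂), U.card ≤ t₂ →
    ∀ V : Strategy q n U, V.Admissible → C.e₂ U V ≤ ε) ∧
  (∀ U : Finset (User M₁ M₂), U.card ≤ t₁ →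
    ∀ V : Strategy q n U, V.Admissible → C.e₁ U V ≤ ε)

/-! ### The random construction -/

/-- The words of Hamming weight `w`. -/
abbrev Sphere (q n w : ℕ) : Type := {x : Word q n // hammingNorm x = w}

theorem sphere_nonempty {q n w : ℕ} (hq : 2 ≤ q) (hw : w ≤ n) : Nonempty (Sphere q n w) := by
  have : Fact (1 < q) := ⟨hq⟩
  refine ⟨⟨fun i => if (i : ℕ) < w then 1 else 0, ?_⟩⟩
  have h1 : ∀ i : Fin n, ((if (i : ℕ) < w then (1 : ZMod q) else 0) ≠ 0) ↔ (i : ℕ) < w := by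
    intro i; split_ifs with h <;> simp [h]
  unfold hammingNorm
  simp only [h1]
  rw [Fin.card_filter_val_lt, min_eq_right hw]

/-- The outcomes of the random experiment: the centers `R i` and the offsets `S i j`. -/
abbrev Choice (q n M₁ M₂ w : ℕ) : Type :=
  (Fin M₁ → Word q n) × (Fin M₁ → Fin M₂ → Sphere q n w)

/-- The fingerprint `R i + S i j` of the user `(i, j)`. -/
def fingerprint {q n M₁ M₂ w : ℕ} (k : Choice q n M₁ M₂ w) (u : User M₁ M₂) : Word q n :=
  k.1 u.1 + (k.2 u.1 u.2 : Word q n)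

/-- `D` is a minimum distance decoder: for every outcome `k`, it outputs a user (any one of
them, in the case of ties) whose fingerprint is closest to the given word. -/
def IsMDDecoder {q n M₁ M₂ w : ℕ}
    (D : Choice q n M₁ M₂ w → Word q n → User M₁ M₂) : Prop :=
  ∀ k y u, hammingDist (fingerprint k (D k y)) y ≤ hammingDist (fingerprint k u) y

/-- The randomized code in which all the centers (uniform over all words) and all the offsets
(uniform over the words of weight `w`) are chosen independently. Tracing uses `D` for the user
and the group of the output of `D` for the group. -/
noncomputable def construction (q n M₁ M₂ w : ℕ) [NeZero q] (hq : 2 ≤ q) (hw : w ≤ n)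
    (D : Choice q n M₁ M₂ w → Word q n → User M₁ M₂) : RandomizedCode q n M₁ M₂ where
  Key := Choice q n M₁ M₂ w
  prob _ := 1 / (Fintype.card (Choice q n M₁ M₂ w) : ℝ)
  prob_nonneg _ := by positivity
  prob_sum := by
    have := sphere_nonempty hq hw
    have h : (Fintype.card (Choice q n M₁ M₂ w) : ℝ) ≠ 0 := by
      exact_mod_cast Fintype.card_ne_zero
    rw [Finset.sum_const, Finset.card_univ, nsmul_eq_mul, mul_one_div_cancel h]
  code k :=
    { enc := fingerprint k
      dec₁ := fun y => some (D k y).1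
      dec₂ := fun y => some (D k y) }

end TwoLevel

/-! The decoded user is at least as close to the forgery `y` as every pirate, so it suffices to
bound the chance that an innocent user comes that close. The center of a group without pirates, or
the offset of an innocent user, is independent of what the coalition sees and hence of `y`. It may
be resampled with everything else fixed (`expect_response_le`). Each error thus becomes a counting
problem followed by a union bound.

Groups (`group_error_le`): where all m ≤ t pirates agree, `y` agrees with them, and elsewhere at
least one pirate agrees with `y`. Agreement has probability at least q^(1-m) per coordinate
(`colProb_agree`). By averaging, some pirate is typically within about (t-1)/t · (1 - q^(1-t)) · n
of `y`, and the center of the decoded group is at most ωn farther away, within ρn in total. A fresh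
uniform center falls into this ball with probability at most q^(n(h(ρ)-1)) (`card_ball_le`), which
beats the q^(nR₁) groups.

Users (`pair_fellow_error_le`): measured from the center of one pirate's group, each letter of `y`
is copied from that pirate's offset or from the other pirate's relative fingerprint. Concentration
confines the relative weight γn of `y` and puts one of the two pirates within about δn. Two pirates
in one group lead to the constraints of f₁, in different groups to those of f₂. An innocent offset
in the same group is uniform among roughly q^(nh(ω)) words, and counting by joint types
(`card_sphere_close_le`) shows that at most about q^(n max φ) of them are close enough. The rate
condition on R₂ absorbs the union bound.

Two tools support this. The uniform law on a sphere is dominated by a product law up to the factor n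
+ 1 (`one_div_card_sphere_le`), which makes coordinates independent. The typical constraints hold
only up to a slack η, and `exists_slack` shows that a small slack raises the maximum of φ only
slightly. -/

namespace TwoLevel

open Finset
open scoped BigOperators

/-! ### Indicators and averages -/

open Classical in
/-- The indicator of a proposition, as a real number. -/
noncomputable def ind (p : Prop) : ℝ := if p then 1 else 0

theorem ind_of {p : Prop} (h : p) : ind p = 1 := if_pos h

theorem ind_of_not {p : Prop} (h : ¬p) : ind p = 0 := if_neg h

theorem ind_nonneg (p : Prop) : 0 ≤ ind p := by
  by_cases h : p <;> simp [ind, h]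

theorem ind_le_one (p : Prop) : ind p ≤ 1 := by
  by_cases h : p <;> simp [ind, h]

theorem ind_mono {p r : Prop} (h : p → r) : ind p ≤ ind r := by
  by_cases hp : p
  · rw [ind_of hp, ind_of (h hp)]
  · rw [ind_of_not hp]; exact ind_nonneg r

theorem ind_not (p : Prop) : ind (¬p) = 1 - ind p := by
  by_cases h : p <;> simp [ind, h]

theorem ind_and (p r : Prop) : ind (p ∧ r) = ind p * ind r := by
  by_cases h : p <;> by_cases h' : r <;> simp [ind, h, h']

theorem ind_or_le (p r : Prop) : ind (p ∨ r) ≤ ind p + ind r := by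
  by_cases h : p <;> by_cases h' : r <;> simp [ind, h, h']

theorem ind_exists_le {ι : Type*} (s : Finset ι) (p : ι → Prop) :
    ind (∃ i ∈ s, p i) ≤ ∑ i ∈ s, ind (p i) := by
  by_cases h : ∃ i ∈ s, p i
  · rw [ind_of h]
    obtain ⟨i, hi, hp⟩ := h
    rw [← ind_of hp]
    exact single_le_sum (f := fun i => ind (p i)) (fun j _ => ind_nonneg _) hi
  · rw [ind_of_not h]
    exact sum_nonneg fun j _ => ind_nonneg _

theorem sum_ind_eq_card {ι : Type*} (s : Finset ι) (p : ι → Prop) [DecidablePred p] :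
    ∑ i ∈ s, ind (p i) = ((s.filter p).card : ℝ) := by
  rw [card_filter]
  push_cast
  refine sum_congr rfl fun i _ => ?_
  by_cases h : p i <;> simp [ind, h]

theorem prod_ind_eq {ι : Type*} (s : Finset ι) (p : ι → Prop) :
    ∏ i ∈ s, ind (p i) = ind (∀ i ∈ s, p i) := by
  by_cases h : ∀ i ∈ s, p i
  · rw [ind_of h]
    exact prod_eq_one fun i hi => ind_of (h i hi)
  · rw [ind_of_not h]
    push Not at h
    obtain ⟨i, hi, hp⟩ := h
    exact prod_eq_zero hi (ind_of_not hp)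

theorem sum_ind_eq_mul {α : Type*} [Fintype α] (a : α) (f : α → ℝ) :
    ∑ x, ind (x = a) * f x = f a := by
  classical
  rw [sum_eq_single a]
  · rw [ind_of rfl, one_mul]
  · intro b _ hb; rw [ind_of_not hb, zero_mul]
  · intro h; exact absurd (mem_univ a) h

/-- Resampling one component of a uniformly distributed object does not change averages. -/
theorem expect_eq_expect_resample {K A : Type*} [Fintype K] [Fintype A] [Nonempty A]
    (get : K → A) (set : K → A → K) (get_set : ∀ k a, get (set k a) = a)
    (set_set_get : ∀ k a, set (set k a) (get k) = k) (F : K → ℝ) :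
    𝔼 k, F k = 𝔼 k, 𝔼 a, F (set k a) := by
  -- Exchanging the stored component with the fresh one is an involution of `K × A`, so it preserves
  -- the uniform law.
  have h1 : 𝔼 p : K × A, F (set p.1 p.2) = 𝔼 p : K × A, F p.1 :=
    Fintype.expect_equiv
      { toFun := fun p => (set p.1 p.2, get p.1)
        invFun := fun p => (set p.1 p.2, get p.1)
        left_inv := fun p => by simp [get_set, set_set_get]
        right_inv := fun p => by simp [get_set, set_set_get] } _ _ fun _ => rfl
  rw [← univ_product_univ, expect_product, expect_product] at h1
  simp only [Fintype.expect_const] at h1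
  exact h1.symm

/-- If the observation `obs` does not depend on the component that is resampled, and the event `E`
has probability at most `B` under resampling whatever the other data, then so it has under any
randomized response to the observation. -/
theorem expect_response_le {K A X Y : Type*} [Fintype K] [Fintype A] [Nonempty A] [Nonempty K]
    [Fintype Y] (get : K → A) (set : K → A → K) (get_set : ∀ k a, get (set k a) = a)
    (set_set_get : ∀ k a, set (set k a) (get k) = k) (obs : K → X)
    (obs_set : ∀ k a, obs (set k a) = obs k) (V : X → Y → ℝ) (hV : ∀ x y, 0 ≤ V x y)
    (hV1 : ∀ x, ∑ y, V x y = 1) (E : K → Y → Prop) (B : ℝ)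
    (hE : ∀ k y, 𝔼 a, ind (E (set k a) y) ≤ B) :
    𝔼 k, ∑ y, V (obs k) y * ind (E k y) ≤ B := by
  rw [expect_eq_expect_resample get set get_set set_set_get]
  refine (expect_le_expect (g := fun _ => B) fun k _ => ?_).trans (Fintype.expect_const B).le
  simp only [obs_set]
  rw [expect_sum_comm]
  simp only [← mul_expect]
  calc ∑ y, V (obs k) y * 𝔼 a, ind (E (set k a) y) ≤ ∑ y, V (obs k) y * B :=
        sum_le_sum fun y _ => mul_le_mul_of_nonneg_left (hE k y) (hV _ _)
    _ = B := by rw [← sum_mul, hV1, one_mul]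

/-! ### A concentration inequality -/

/-- Chernoff's method with parameter s = η/2: the exponent n(s² - sη) is minimal there and equals
-nη²/4. -/
theorem sum_prod_ind_le_exp {A : Type*} [Fintype A] (n : ℕ) (P : A → ℝ) (hP : ∀ a, 0 ≤ P a)
    (hP1 : ∑ a, P a = 1) (f : A → ℝ) (hf : ∀ a, 0 ≤ f a ∧ f a ≤ 1) (μ η : ℝ)
    (hμ : μ ≤ ∑ a, P a * f a) (hη : 0 ≤ η) (hη1 : η ≤ 1) :
    ∑ z : Fin n → A, (∏ l, P (z l)) * ind (∑ l, f (z l) ≤ n * (μ - η)) ≤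
      Real.exp (-(n * η ^ 2 / 4)) := by
  classical
  -- The exponential moment is bounded through |eˣ - 1 - x| ≤ x², valid for |x| ≤ 1; here |x| ≤ η/2.
  have hexp : ∑ a, P a * Real.exp (-(η / 2 * f a)) ≤ Real.exp (-(η / 2 * μ) + (η / 2) ^ 2) := by
    calc ∑ a, P a * Real.exp (-(η / 2 * f a))
        ≤ ∑ a, (P a - η / 2 * (P a * f a) + P a * (η / 2) ^ 2) := by
          refine sum_le_sum fun a _ => ?_
          have h0 := (hf a).1
          have h1 := (hf a).2
          have hx0 : 0 ≤ η / 2 * f a := by positivity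
          have hx1 : η / 2 * f a ≤ η / 2 := by nlinarith
          have := (abs_le.1 (Real.abs_exp_sub_one_sub_id_le (x := -(η / 2 * f a))
            (by rw [abs_neg, abs_of_nonneg hx0]; linarith))).2
          have hsq : (η / 2 * f a) ^ 2 ≤ (η / 2) ^ 2 := pow_le_pow_left₀ hx0 hx1 2
          have h2 : Real.exp (-(η / 2 * f a)) ≤ 1 - η / 2 * f a + (η / 2) ^ 2 := by nlinarith
          have := mul_le_mul_of_nonneg_left h2 (hP a)
          linarith
      _ = 1 - η / 2 * (∑ a, P a * f a) + (η / 2) ^ 2 := by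
          rw [sum_add_distrib, sum_sub_distrib, ← mul_sum, ← sum_mul, hP1, one_mul]
      _ ≤ -(η / 2 * μ) + (η / 2) ^ 2 + 1 := by nlinarith
      _ ≤ _ := Real.add_one_le_exp _
  calc ∑ z : Fin n → A, (∏ l, P (z l)) * ind (∑ l, f (z l) ≤ n * (μ - η))
      ≤ ∑ z : Fin n → A, Real.exp (η / 2 * (n * (μ - η))) *
          ∏ l, (P (z l) * Real.exp (-(η / 2 * f (z l)))) := by
        refine sum_le_sum fun z _ => ?_
        rw [prod_mul_distrib, ← Real.exp_sum, mul_left_comm]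
        refine mul_le_mul_of_nonneg_left ?_ (prod_nonneg fun l _ => hP _)
        rw [← Real.exp_add, sum_neg_distrib, ← mul_sum]
        by_cases h : ∑ l, f (z l) ≤ n * (μ - η)
        · rw [ind_of h, Real.one_le_exp_iff]
          nlinarith
        · rw [ind_of_not h]; positivity
    _ = Real.exp (η / 2 * (n * (μ - η))) * (∑ a, P a * Real.exp (-(η / 2 * f a))) ^ n := by
        rw [← mul_sum, ← Fintype.piFinset_univ,
          ← prod_univ_sum (fun _ => univ) fun _ a => P a * Real.exp (-(η / 2 * f a))]
        simp
    _ ≤ Real.exp (η / 2 * (n * (μ - η))) * Real.exp (-(η / 2 * μ) + (η / 2) ^ 2) ^ n := by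
        refine mul_le_mul_of_nonneg_left (pow_le_pow_left₀ ?_ hexp n) (Real.exp_pos _).le
        exact sum_nonneg fun a _ => mul_nonneg (hP a) (Real.exp_pos _).le
    _ = _ := by
        rw [← Real.exp_nat_mul, ← Real.exp_add]
        congr 1; ring

/-! ### Product distributions and spheres -/

/-- The distribution of one letter that is nonzero with probability `ω`. -/
noncomputable def letterProb (q : ℕ) (ω : ℝ) (x : ZMod q) : ℝ :=
  if x = 0 then 1 - ω else ω / ((q : ℝ) - 1)

theorem letterProb_nonneg {q : ℕ} (hq : 3 ≤ q) {ω : ℝ} (hω : ω ∈ Set.Icc (0 : ℝ) 1)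
    (x : ZMod q) : 0 ≤ letterProb q ω x := by
  have : (3 : ℝ) ≤ q := by exact_mod_cast hq
  unfold letterProb
  split_ifs
  · linarith [hω.2]
  · exact div_nonneg hω.1 (by linarith)

theorem sum_letter {q : ℕ} [NeZero q] (a b : ℝ) :
    ∑ x : ZMod q, (if x = 0 then a else b) = a + ((q : ℝ) - 1) * b := by
  rw [sum_ite, filter_eq', if_pos (mem_univ _), sum_singleton, sum_const, filter_ne',
    card_erase_of_mem (mem_univ _), card_univ, ZMod.card, nsmul_eq_mul,
    Nat.cast_sub (NeZero.one_le), Nat.cast_one]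

theorem sum_letterProb {q : ℕ} [NeZero q] (hq : 3 ≤ q) (ω : ℝ) :
    ∑ x : ZMod q, letterProb q ω x = 1 := by
  have : (3 : ℝ) ≤ q := by exact_mod_cast hq
  have h : (q : ℝ) - 1 ≠ 0 := by linarith
  unfold letterProb
  rw [sum_letter]
  field_simp
  ring

theorem prod_letterProb {q n : ℕ} (ω : ℝ) (x : Word q n) :
    ∏ l, letterProb q ω (x l) =
      (1 - ω) ^ (n - hammingNorm x) * (ω / ((q : ℝ) - 1)) ^ hammingNorm x := by
  unfold letterProb hammingNorm
  rw [prod_ite, prod_const, prod_const]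
  congr 2
  have := card_filter_add_card_filter_not (s := (univ : Finset (Fin n))) (fun l => x l = 0)
  rw [card_univ, Fintype.card_fin] at this
  simp only [ne_eq] at this ⊢
  omega

theorem sum_prod_letterProb {q n : ℕ} [NeZero q] (hq : 3 ≤ q) (ω : ℝ) :
    ∑ x : Word q n, ∏ l, letterProb q ω (x l) = 1 := by
  rw [← Fintype.piFinset_univ, ← prod_univ_sum (fun _ => univ) fun _ a => letterProb q ω a]
  simp [sum_letterProb hq]

/-- The alternative `k = 0` admits 0⁰ = 1, which occurs for ω = 0 or 1 and for empty joint types. -/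
theorem pow_eq_exp_mul_log {x : ℝ} {k : ℕ} (h : 0 < x ∨ k = 0) :
    x ^ k = Real.exp (k * Real.log x) := by
  rcases h with h | h
  · rw [Real.exp_nat_mul, Real.exp_log h]
  · simp [h]

theorem card_filter_hammingNorm_eq {q n : ℕ} [NeZero q] (k : ℕ) :
    (univ.filter fun x : Word q n => hammingNorm x = k).card = n.choose k * (q - 1) ^ k := by
  classical
  -- Words are grouped by support: each letter on the support has q - 1 possible values.
  have h : ∀ s ∈ powersetCard k (univ : Finset (Fin n)),
      ((univ.filter fun x : Word q n => hammingNorm x = k).filter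
        fun x => (univ.filter fun l => x l ≠ 0) = s).card = (q - 1) ^ k := by
    intro s hs
    have hs' := (mem_powersetCard.1 hs).2
    have : ((univ.filter fun x : Word q n => hammingNorm x = k).filter
        fun x => (univ.filter fun l => x l ≠ 0) = s) =
        Fintype.piFinset fun l => if l ∈ s then univ.erase (0 : ZMod q) else {0} := by
      ext x
      simp only [mem_filter, mem_univ, true_and, Fintype.mem_piFinset]
      constructor
      · rintro ⟨_, h⟩ l
        by_cases hl : l ∈ s
        · rw [if_pos hl, mem_erase]
          rw [← h] at hl
          exact ⟨(mem_filter.1 hl).2, mem_univ _⟩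
        · rw [if_neg hl, mem_singleton]
          by_contra hx
          exact hl (h ▸ mem_filter.2 ⟨mem_univ _, hx⟩)
      · intro h
        have h2 : (univ.filter fun l => x l ≠ 0) = s := by
          ext l
          have := h l
          by_cases hl : l ∈ s
          · rw [if_pos hl, mem_erase] at this
            simp [hl, this.1]
          · rw [if_neg hl, mem_singleton] at this
            simp [hl, this]
        exact ⟨by unfold hammingNorm; rw [h2, hs'], h2⟩
    rw [this, Fintype.card_piFinset]
    have h3 : ∀ l, (if l ∈ s then univ.erase (0 : ZMod q) else {0}).card =
        if l ∈ s then q - 1 else 1 := by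
      intro l
      split_ifs
      · rw [card_erase_of_mem (mem_univ _), card_univ, ZMod.card]
      · simp
    simp only [h3]
    rw [prod_ite_mem, univ_inter, prod_const, hs']
  rw [card_eq_sum_card_fiberwise (t := powersetCard k univ)
    (f := fun x : Word q n => univ.filter fun l => x l ≠ 0), sum_congr rfl h, sum_const,
    card_powersetCard, card_univ, Fintype.card_fin, smul_eq_mul]
  intro x hx
  simpa [mem_powersetCard, hammingNorm] using hx

/-- The Poisson weight w^k / k! is largest at k = w, since consecutive ratios w / (k + 1) pass 1
there. -/
theorem pow_mul_factorial_le (w k : ℕ) : w ^ k * w.factorial ≤ w ^ w * k.factorial := by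
  rcases le_total w k with h | h
  · obtain ⟨m, rfl⟩ := Nat.exists_eq_add_of_le h
    calc w ^ (w + m) * w.factorial = w ^ w * (w.factorial * w ^ m) := by ring
      _ ≤ w ^ w * (w.factorial * (w + 1) ^ m) := by gcongr; omega
      _ ≤ w ^ w * (w + m).factorial := Nat.mul_le_mul_left _ Nat.factorial_mul_pow_le_factorial
  · obtain ⟨m, rfl⟩ := Nat.exists_eq_add_of_le h
    have : (k + m).factorial ≤ (k + m) ^ m * k.factorial := by
      have h := Nat.factorial_mul_descFactorial (Nat.le_add_left m k)
      rw [Nat.add_sub_cancel] at h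
      rw [← h, mul_comm]
      exact Nat.mul_le_mul_right _ (Nat.descFactorial_le_pow _ _)
    calc (k + m) ^ k * (k + m).factorial ≤ (k + m) ^ k * ((k + m) ^ m * k.factorial) := by gcongr
      _ = _ := by ring

/-- The most likely number of successes is the mean, when this is an integer. -/
theorem choose_mul_pow_le (n w k : ℕ) (hw : w ≤ n) (hk : k ≤ n) :
    n.choose k * (w ^ k * (n - w) ^ (n - k)) ≤ n.choose w * (w ^ w * (n - w) ^ (n - w)) := by
  have h1 := pow_mul_factorial_le w k
  have h2 := pow_mul_factorial_le (n - w) (n - k)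
  have h3 := Nat.choose_mul_factorial_mul_factorial hw
  have h4 := Nat.choose_mul_factorial_mul_factorial hk
  have hpos : 0 < k.factorial * (n - k).factorial * (w.factorial * (n - w).factorial) := by
    positivity
  refine Nat.le_of_mul_le_mul_right ?_ hpos
  calc n.choose k * (w ^ k * (n - w) ^ (n - k)) * (k.factorial * (n - k).factorial *
        (w.factorial * (n - w).factorial))
      = (n.choose k * k.factorial * (n - k).factorial) *
        ((w ^ k * w.factorial) * ((n - w) ^ (n - k) * (n - w).factorial)) := by ring
    _ = (n.choose w * w.factorial * (n - w).factorial) *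
        ((w ^ k * w.factorial) * ((n - w) ^ (n - k) * (n - w).factorial)) := by rw [h3, h4]
    _ ≤ (n.choose w * w.factorial * (n - w).factorial) *
        ((w ^ w * k.factorial) * ((n - w) ^ (n - w) * (n - k).factorial)) := by gcongr
    _ = _ := by ring

/-- The uniform distribution on a sphere is dominated, up to a factor `n + 1`, by the product
distribution. -/
theorem one_div_card_sphere_le {q n w : ℕ} [NeZero q] (hq : 3 ≤ q) (hw : w ≤ n) {ω : ℝ}
    (hwω : (w : ℝ) = ω * n) (s : Sphere q n w) :
    1 / (Fintype.card (Sphere q n w) : ℝ) ≤ (n + 1) * ∏ l, letterProb q ω (s.1 l) := by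
  have hq' : (3 : ℝ) ≤ q := by exact_mod_cast hq
  have hq1 : (q : ℝ) - 1 ≠ 0 := by linarith
  have hcard : (Fintype.card (Sphere q n w) : ℝ) = n.choose w * ((q : ℝ) - 1) ^ w := by
    rw [Fintype.card_subtype, card_filter_hammingNorm_eq]
    push_cast [Nat.cast_sub (NeZero.one_le : 1 ≤ q)]
    rfl
  have hpos : (0 : ℝ) < Fintype.card (Sphere q n w) := by
    have := sphere_nonempty (q := q) (by omega) hw
    exact_mod_cast Fintype.card_pos
  have hmode : ∀ k ≤ n, (n.choose k : ℝ) * (ω ^ k * (1 - ω) ^ (n - k)) ≤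
      n.choose w * (ω ^ w * (1 - ω) ^ (n - w)) := by
    intro k hk
    rcases Nat.eq_zero_or_pos n with h0 | hn
    · subst h0
      obtain rfl : k = 0 := by omega
      obtain rfl : w = 0 := by omega
      simp
    have hn' : (0 : ℝ) < n := by exact_mod_cast hn
    have h := choose_mul_pow_le n w k hw hk
    have h' : (n.choose k : ℝ) * ((w : ℝ) ^ k * ((n : ℝ) - w) ^ (n - k)) ≤
        n.choose w * ((w : ℝ) ^ w * ((n : ℝ) - w) ^ (n - w)) := by
      rw [← Nat.cast_sub hw]; exact_mod_cast h
    have e1 : (n : ℝ) - w = (1 - ω) * n := by rw [hwω]; ring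
    rw [e1, hwω, mul_pow, mul_pow, mul_pow, mul_pow] at h'
    have e2 : (n : ℝ) ^ k * (n : ℝ) ^ (n - k) = (n : ℝ) ^ n := by
      rw [← pow_add]; congr 1; omega
    have e3 : (n : ℝ) ^ w * (n : ℝ) ^ (n - w) = (n : ℝ) ^ n := by
      rw [← pow_add]; congr 1; omega
    refine le_of_mul_le_mul_right ?_ (pow_pos hn' n)
    calc _ = (n.choose k : ℝ) * (ω ^ k * (n : ℝ) ^ k * ((1 - ω) ^ (n - k) * (n : ℝ) ^ (n - k))) := by
          rw [← e2]; ring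
      _ ≤ _ := h'
      _ = _ := by rw [← e3]; ring
  -- The n + 1 binomial weights add up to 1, so the largest of them, at w, is at least 1 / (n + 1).
  -- The product law is constant on the sphere, whose mass is this weight.
  have hone : 1 ≤ ((n : ℝ) + 1) * (n.choose w * (ω ^ w * (1 - ω) ^ (n - w))) := by
    have := add_pow ω (1 - ω) n
    rw [add_sub_cancel, one_pow] at this
    refine this.trans_le ?_
    calc ∑ k ∈ range (n + 1), ω ^ k * (1 - ω) ^ (n - k) * (n.choose k : ℝ)
        ≤ ∑ k ∈ range (n + 1), (n.choose w : ℝ) * (ω ^ w * (1 - ω) ^ (n - w)) := by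
          refine sum_le_sum fun k hk => ?_
          rw [mul_comm]
          exact hmode k (by simpa [Nat.lt_succ_iff] using hk)
      _ = _ := by simp
  rw [prod_letterProb, s.2, div_le_iff₀ hpos, hcard]
  calc 1 ≤ _ := hone
    _ = _ := by
      rw [div_pow]
      have := pow_ne_zero w hq1
      field_simp

theorem prod_letterProb_sphere {q n w : ℕ} (hq : 3 ≤ q) (hw : w ≤ n) {ω : ℝ}
    (hω : ω ∈ Set.Icc (0 : ℝ) 1) (hwω : (w : ℝ) = ω * n) (s : Sphere q n w) :
    ∏ l, letterProb q ω (s.1 l) = (q : ℝ) ^ (-(n * entropy q ω)) := by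
  have hq' : (3 : ℝ) ≤ q := by exact_mod_cast hq
  have hq1 : 0 < (q : ℝ) - 1 := by linarith
  have hlog : 0 < Real.log q := Real.log_pos (by linarith)
  have e1 : ((n - w : ℕ) : ℝ) = (1 - ω) * n := by rw [Nat.cast_sub hw, hwω]; ring
  have h1 : 0 < 1 - ω ∨ n - w = 0 := by
    rcases hω.2.lt_or_eq with h | h
    · left; linarith
    · right; rw [h, sub_self, zero_mul] at e1; exact_mod_cast e1
  have h2 : 0 < ω / ((q : ℝ) - 1) ∨ w = 0 := by
    rcases hω.1.lt_or_eq with h | h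
    · left; positivity
    · right; rw [← h, zero_mul] at hwω; exact_mod_cast hwω
  rw [prod_letterProb, s.2, pow_eq_exp_mul_log h1, pow_eq_exp_mul_log h2, ← Real.exp_add,
    Real.rpow_def_of_pos (by linarith), e1, hwω]
  congr 1
  unfold entropy Real.logb
  field_simp
  ring

theorem one_div_card_sphere_le_rpow {q n w : ℕ} [NeZero q] (hq : 3 ≤ q) (hw : w ≤ n) {ω : ℝ}
    (hω : ω ∈ Set.Icc (0 : ℝ) 1) (hwω : (w : ℝ) = ω * n) :
    1 / (Fintype.card (Sphere q n w) : ℝ) ≤ (n + 1) * (q : ℝ) ^ (-(n * entropy q ω)) := by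
  obtain ⟨s⟩ := sphere_nonempty (q := q) (by omega) hw
  rw [← prod_letterProb_sphere hq hw hω hwω s]
  exact one_div_card_sphere_le hq hw hwω s

/-- Volume of Hamming balls. -/
theorem card_ball_le {q n : ℕ} [NeZero q] (hq : 3 ≤ q) (y : Word q n) {ρ : ℝ} (h0 : 0 < ρ)
    (hρ : ρ ≤ ((q : ℝ) - 1) / q) :
    ((univ.filter fun r : Word q n => (hammingDist r y : ℝ) ≤ ρ * n).card : ℝ) ≤
      (q : ℝ) ^ (n * entropy q ρ) := by
  have hq' : (3 : ℝ) ≤ q := by exact_mod_cast hq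
  have hq0 : (0 : ℝ) < q := by linarith
  have hq1 : 0 < (q : ℝ) - 1 := by linarith
  have hlog : 0 < Real.log q := Real.log_pos (by linarith)
  have hρ2 : ρ * q ≤ q - 1 := by rwa [le_div_iff₀ hq0] at hρ
  have hρ1 : ρ < 1 := by nlinarith
  have hp1 : 0 < 1 - ρ := by linarith
  have hp2 : 0 < ρ / ((q : ℝ) - 1) := by positivity
  have hle : ρ / ((q : ℝ) - 1) ≤ 1 - ρ := by rw [div_le_iff₀ hq1]; nlinarith
  have hlogle := Real.log_le_log hp2 hle
  -- The condition ρ ≤ (q-1)/q makes 0 at least as likely as any other letter. The product law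
  -- around `y` therefore decreases with the distance, and at distance ρn its value is q^(-n h(ρ)).
  have key : ∀ r ∈ univ.filter fun r : Word q n => (hammingDist r y : ℝ) ≤ ρ * n,
      (q : ℝ) ^ (-(n * entropy q ρ)) ≤ ∏ l, letterProb q ρ ((y - r) l) := by
    intro r hr
    have hr' := (mem_filter.1 hr).2
    rw [hammingDist_eq_hammingNorm, neg_add_eq_sub] at hr'
    have hkn : hammingNorm (y - r) ≤ n := by
      simpa using hammingNorm_le_card_fintype (x := y - r)
    rw [prod_letterProb, pow_eq_exp_mul_log (Or.inl hp1), pow_eq_exp_mul_log (Or.inl hp2),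
      ← Real.exp_add, Real.rpow_def_of_pos hq0, Real.exp_le_exp, Nat.cast_sub hkn]
    have e : Real.log q * -(n * entropy q ρ) =
        n * (ρ * Real.log (ρ / ((q : ℝ) - 1)) + (1 - ρ) * Real.log (1 - ρ)) := by
      unfold entropy Real.logb
      field_simp
      ring
    rw [e]
    nlinarith [mul_nonneg (sub_nonneg.2 hr') (sub_nonneg.2 hlogle)]
  have hsum : ((univ.filter fun r : Word q n => (hammingDist r y : ℝ) ≤ ρ * n).card : ℝ) *
      (q : ℝ) ^ (-(n * entropy q ρ)) ≤ 1 := by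
    calc _ = ∑ r ∈ univ.filter fun r : Word q n => (hammingDist r y : ℝ) ≤ ρ * n,
          (q : ℝ) ^ (-(n * entropy q ρ)) := by rw [sum_const, nsmul_eq_mul]
      _ ≤ ∑ r ∈ univ.filter fun r : Word q n => (hammingDist r y : ℝ) ≤ ρ * n,
          ∏ l, letterProb q ρ ((y - r) l) := sum_le_sum key
      _ ≤ ∑ r : Word q n, ∏ l, letterProb q ρ ((y - r) l) :=
          sum_le_univ_sum_of_nonneg fun r =>
            prod_nonneg fun l _ => letterProb_nonneg hq ⟨h0.le, hρ1.le⟩ _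
      _ = ∑ r : Word q n, ∏ l, letterProb q ρ (r l) :=
          Fintype.sum_equiv (Equiv.subLeft y) _ _ fun r => rfl
      _ = 1 := sum_prod_letterProb hq ρ
  rw [Real.rpow_neg hq0.le, ← div_eq_mul_inv, div_le_one (by positivity)] at hsum
  exact hsum

/-! ### The exponent `φ` -/

/-- The exponent `φ` in natural units, written without quotients. -/
noncomputable def natPhi (q : ℕ) (ω γ α β : ℝ) : ℝ :=
  α * Real.log ((q : ℝ) - 1) + (ω - α - β) * Real.log ((q : ℝ) - 2)
    + (Real.negMulLog α + Real.negMulLog (1 - γ - α) - Real.negMulLog (1 - γ))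
    + (Real.negMulLog β + Real.negMulLog (ω - α - β) + Real.negMulLog (γ + α - ω)
      - Real.negMulLog γ)

/-- Clearing the quotient leaves only `negMulLog`, so the boundary cases need no convention. At c =
0 both sides vanish. -/
theorem mul_entropy_div {q : ℕ} (hq : 3 ≤ q) {a c : ℝ} (ha : 0 ≤ a) (hac : a ≤ c) :
    c * entropy q (a / c) = (a * Real.log ((q : ℝ) - 1) + Real.negMulLog a
      + Real.negMulLog (c - a) - Real.negMulLog c) / Real.log q := by
  have hq' : (3 : ℝ) ≤ q := by exact_mod_cast hq
  have hq1 : (q : ℝ) - 1 ≠ 0 := by linarith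
  have hlog : Real.log q ≠ 0 := (Real.log_pos (by linarith)).ne'
  rcases (ha.trans hac).eq_or_lt with hc | hc
  · obtain rfl : a = 0 := by linarith
    simp [← hc]
  have h1 : c * (a / c * Real.log (a / c / ((q : ℝ) - 1))) =
      a * (Real.log a - Real.log c - Real.log ((q : ℝ) - 1)) := by
    rcases ha.eq_or_lt with h | h
    · simp [← h]
    · rw [Real.log_div (by positivity) hq1, Real.log_div h.ne' hc.ne']
      field_simp
  have h2 : c * ((1 - a / c) * Real.log (1 - a / c)) =
      (c - a) * (Real.log (c - a) - Real.log c) := by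
    have e : 1 - a / c = (c - a) / c := by field_simp
    rcases hac.eq_or_lt with h | h
    · simp [h, hc.ne']
    · rw [e, Real.log_div (by linarith) hc.ne']
      field_simp
  have h3 : c * entropy q (a / c) = (-(c * (a / c * Real.log (a / c / ((q : ℝ) - 1))))
      - c * ((1 - a / c) * Real.log (1 - a / c))) / Real.log q := by
    unfold entropy Real.logb
    ring
  rw [h3, h1, h2]
  unfold Real.negMulLog
  ring

theorem phi_eq_natPhi {q : ℕ} (hq : 3 ≤ q) {ω γ α β : ℝ} (h : PhiDomain ω γ α β) :
    phi q ω γ α β = natPhi q ω γ α β / Real.log q := by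
  have hq' : (3 : ℝ) ≤ q := by exact_mod_cast hq
  obtain ⟨hγ, hα, hβ, h1, h2, h3, h4⟩ := h
  unfold phi natPhi
  rw [mul_entropy_div hq hα.1 h1, mul_entropy_div hq (by linarith) (by linarith),
    mul_entropy_div hq hβ.1 h2, Real.logb, Real.logb, Real.log_div (by linarith) (by linarith),
    show γ - β - (ω - α - β) = γ + α - ω by ring]
  ring

theorem negMulLog_add_le {a b : ℝ} (ha : 0 ≤ a) (hb : 0 ≤ b) :
    Real.negMulLog (a + b) ≤ Real.negMulLog a + Real.negMulLog b := by
  have h : ∀ x y : ℝ, 0 ≤ x → 0 ≤ y → x * Real.log x ≤ x * Real.log (x + y) := by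
    intro x y hx hy
    rcases hx.eq_or_lt with h | h
    · simp [← h]
    · exact mul_le_mul_of_nonneg_left (Real.log_le_log h (by linarith)) hx
  have h1 := h a b ha hb
  have h2 := h b a hb ha
  rw [add_comm b a] at h2
  unfold Real.negMulLog
  linarith

/-- Each group of entropy terms is nonnegative by subadditivity of `negMulLog`, and q ≥ 3 makes the
logarithmic coefficients nonnegative. The resulting sign of f₁ serves for coalitions of one pirate.
-/
theorem phi_nonneg {q : ℕ} (hq : 3 ≤ q) {ω γ α β : ℝ} (h : PhiDomain ω γ α β) :
    0 ≤ phi q ω γ α β := by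
  rw [phi_eq_natPhi hq h]
  have hq' : (3 : ℝ) ≤ q := by exact_mod_cast hq
  obtain ⟨hγ, hα, hβ, h1, h2, h3, h4⟩ := h
  have l1 := Real.log_nonneg (x := (q : ℝ) - 1) (by linarith)
  have l2 := Real.log_nonneg (x := (q : ℝ) - 2) (by linarith)
  have n1 := negMulLog_add_le hα.1 (sub_nonneg.2 h1)
  have n2 := negMulLog_add_le (a := ω - α - β) (b := γ + α - ω) (by linarith) (by linarith)
  have n3 := negMulLog_add_le (a := β) (b := γ - β) hβ.1 (by linarith)
  rw [add_sub_cancel] at n1 n3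
  rw [show ω - α - β + (γ + α - ω) = γ - β by ring] at n2
  have p1 := mul_nonneg hα.1 l1
  have p2 := mul_nonneg (show 0 ≤ ω - α - β by linarith) l2
  refine div_nonneg ?_ (Real.log_nonneg (by linarith))
  unfold natPhi
  linarith

/-- The quotient-free form is continuous everywhere, including the faces γ = 0, γ = 1 and γ = β,
where the quotients in φ degenerate. -/
theorem continuous_natPhi (q : ℕ) (ω : ℝ) :
    Continuous fun p : ℝ × ℝ × ℝ => natPhi q ω p.1 p.2.1 p.2.2 := by
  unfold natPhi
  have := Real.continuous_negMulLog
  fun_prop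

theorem isCompact_phiDomain (ω : ℝ) :
    IsCompact {p : ℝ × ℝ × ℝ | PhiDomain ω p.1 p.2.1 p.2.2} := by
  refine (isCompact_Icc.prod (isCompact_Icc.prod isCompact_Icc) :
    IsCompact (Set.Icc (0 : ℝ) 1 ×ˢ Set.Icc (0 : ℝ) 1 ×ˢ Set.Icc (0 : ℝ) 1)).of_isClosed_subset ?_
    fun p hp => ⟨hp.1, hp.2.1, hp.2.2.1⟩
  unfold PhiDomain
  simp only [Set.mem_Icc, Set.ofPred_and]
  repeat' apply IsClosed.inter
  all_goals exact isClosed_le (by fun_prop) (by fun_prop)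

/-- The maximum of `φ` under linear constraints is upper semicontinuous in the constraints. -/
theorem exists_slack {q : ℕ} (hq : 3 ≤ q) (ω lo hi δ c : ℝ) (hc : 0 < c) :
    ∃ η₀ > 0, ∀ γ α β, PhiDomain ω γ α β → lo - η₀ ≤ γ → γ ≤ hi + η₀ → γ - β + α ≤ δ + η₀ →
      phi q ω γ α β ≤ sSup {v : ℝ | ∃ γ α β : ℝ, PhiDomain ω γ α β ∧
        lo ≤ γ ∧ γ ≤ hi ∧ γ - β + α ≤ δ ∧ v = phi q ω γ α β} + c := by
  set S := {v : ℝ | ∃ γ α β : ℝ, PhiDomain ω γ α β ∧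
    lo ≤ γ ∧ γ ≤ hi ∧ γ - β + α ≤ δ ∧ v = phi q ω γ α β} with hS
  have hcont := (continuous_natPhi q ω).div_const (Real.log q)
  have hbdd : BddAbove S := by
    obtain ⟨B, hB⟩ := (isCompact_phiDomain ω).bddAbove_image hcont.continuousOn
    refine ⟨B, ?_⟩
    rintro v ⟨γ, α, β, hd, -, -, -, rfl⟩
    rw [phi_eq_natPhi hq hd]
    exact hB ⟨(γ, α, β), hd, rfl⟩
  -- `K` collects the points where φ exceeds the supremum by at least `c`. The function `g` below
  -- measures the largest violation of the constraints. It is positive on the compact set `K`, hence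
  -- bounded away from 0, and half its minimum is an admissible slack.
  let K := {p : ℝ × ℝ × ℝ | PhiDomain ω p.1 p.2.1 p.2.2} ∩
    {p | sSup S + c ≤ natPhi q ω p.1 p.2.1 p.2.2 / Real.log q}
  have hK : IsCompact K := (isCompact_phiDomain ω).inter_right (isClosed_le continuous_const hcont)
  let g : ℝ × ℝ × ℝ → ℝ := fun p => max (lo - p.1) (max (p.1 - hi) (p.1 - p.2.2 + p.2.1 - δ))
  have hg : Continuous g := by fun_prop
  have hmem : ∀ γ α β, PhiDomain ω γ α β → sSup S + c ≤ phi q ω γ α β → (γ, α, β) ∈ K :=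
    fun γ α β hd h => ⟨hd, by rwa [phi_eq_natPhi hq hd] at h⟩
  rcases K.eq_empty_or_nonempty with hE | hne
  · refine ⟨1, one_pos, fun γ α β hd _ _ _ => ?_⟩
    by_contra! h
    have := hmem γ α β hd h.le
    rw [hE] at this
    exact this
  obtain ⟨p, hp, hmin⟩ := hK.exists_isMinOn hne hg.continuousOn
  have hpos : 0 < g p := by
    by_contra! h
    obtain ⟨h1, h2, h3⟩ : lo - p.1 ≤ 0 ∧ p.1 - hi ≤ 0 ∧ p.1 - p.2.2 + p.2.1 - δ ≤ 0 := by
      simpa [g] using h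
    have hpS : phi q ω p.1 p.2.1 p.2.2 ∈ S :=
      ⟨p.1, p.2.1, p.2.2, hp.1, by linarith, by linarith, by linarith, rfl⟩
    have hle := le_csSup hbdd hpS
    have hge : sSup S + c ≤ natPhi q ω p.1 p.2.1 p.2.2 / Real.log q := hp.2
    rw [← phi_eq_natPhi hq hp.1] at hge
    linarith
  refine ⟨g p / 2, by positivity, fun γ α β hd h1 h2 h3 => ?_⟩
  by_contra! h
  have h4 : g p ≤ g (γ, α, β) := hmin (hmem γ α β hd h.le)
  have h5 : g (γ, α, β) ≤ g p / 2 :=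
    max_le (by simp only; linarith) (max_le (by simp only; linarith) (by simp only; linarith))
  linarith

theorem f1_nonneg {q : ℕ} (hq : 3 ≤ q) (ω : ℝ) : 0 ≤ f1 q ω := by
  refine Real.sSup_nonneg ?_
  rintro v ⟨γ, α, β, hd, -, -, -, rfl⟩
  exact phi_nonneg hq hd

/-! ### Counting the words of a sphere that are close to a given word -/

theorem natCast_mul_log_div {n k m : ℕ} (hn : 0 < n) (hkm : k ≤ m) :
    (k : ℝ) * Real.log (k / m) =
      -(n * Real.negMulLog (k / n)) - k * Real.log ((m : ℝ) / n) := by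
  have hn' : (n : ℝ) ≠ 0 := by positivity
  rcases Nat.eq_zero_or_pos k with rfl | hk
  · simp
  have hk' : (k : ℝ) ≠ 0 := by positivity
  have hm' : (m : ℝ) ≠ 0 := by
    have : 0 < m := by omega
    positivity
  unfold Real.negMulLog
  rw [Real.log_div hk' hm', Real.log_div hk' hn', Real.log_div hm' hn']
  field_simp
  ring

/-- The joint type of two letters: both zero, only the second nonzero, equal and nonzero,
only the first nonzero, different and nonzero. -/
def pairType {q : ℕ} (y x : ZMod q) : Fin 5 :=
  if y = 0 then (if x = 0 then 0 else 1) else (if x = y then 2 else if x = 0 then 3 else 4)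

/-- Weights that turn the conditional type of a word into a probability distribution. -/
noncomputable def typeWeight (q m g : ℕ) (k : Fin 5 → ℕ) (j : Fin 5) : ℝ :=
  ![(k 0 : ℝ) / m, (k 1 : ℝ) / m / ((q : ℝ) - 1), (k 2 : ℝ) / g, (k 3 : ℝ) / g,
    (k 4 : ℝ) / g / ((q : ℝ) - 2)] j

/-- The weights are the conditional law of the second letter given whether the first is zero. The
sum can drop to 0 when `m` or `g` is 0, by division by zero, so only an inequality holds. -/
theorem sum_typeWeight_le {q m g : ℕ} [NeZero q] (hq : 3 ≤ q) (k : Fin 5 → ℕ)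
    (hm : k 0 + k 1 = m) (hg : k 2 + k 3 + k 4 = g) (y : ZMod q) :
    ∑ x : ZMod q, typeWeight q m g k (pairType y x) ≤ 1 := by
  have hq' : (3 : ℝ) ≤ q := by exact_mod_cast hq
  have hq1 : (q : ℝ) - 1 ≠ 0 := by linarith
  have hq2 : (q : ℝ) - 2 ≠ 0 := by linarith
  have hmR : (k 0 : ℝ) + k 1 = m := by exact_mod_cast hm
  have hgR : (k 2 : ℝ) + k 3 + k 4 = g := by exact_mod_cast hg
  by_cases hy : y = 0
  · have e : ∀ x : ZMod q, typeWeight q m g k (pairType y x) =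
        if x = 0 then (k 0 : ℝ) / m else (k 1 : ℝ) / m / ((q : ℝ) - 1) := by
      intro x
      unfold pairType
      rw [if_pos hy]
      split_ifs <;> rfl
    simp only [e]
    rw [sum_letter, mul_div_cancel₀ _ hq1, ← add_div, hmR]
    exact div_self_le_one _
  · have e : ∀ x : ZMod q, typeWeight q m g k (pairType y x) =
        (if x = 0 then (k 3 : ℝ) / g else (k 4 : ℝ) / g / ((q : ℝ) - 2)) +
          (if x = y then (k 2 : ℝ) / g - (k 4 : ℝ) / g / ((q : ℝ) - 2) else 0) := by
      intro x
      unfold pairType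
      rw [if_neg hy]
      by_cases h1 : x = y
      · have : x ≠ 0 := h1 ▸ hy
        rw [if_pos h1, if_pos h1, if_neg this]
        unfold typeWeight
        simp
      · rw [if_neg h1, if_neg h1, add_zero]
        split_ifs <;> rfl
    simp only [e]
    rw [sum_add_distrib, sum_letter, sum_ite_eq' univ y, if_pos (mem_univ _)]
    have : (k 3 : ℝ) / g + ((q : ℝ) - 1) * (k 4 / g / ((q : ℝ) - 2)) +
        ((k 2 : ℝ) / g - k 4 / g / ((q : ℝ) - 2)) = g / g := by
      rw [← hgR]
      field_simp
      ring
    rw [this]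
    exact div_self_le_one _

theorem typeWeight_nonneg {q m g : ℕ} (hq : 3 ≤ q) (k : Fin 5 → ℕ) (j : Fin 5) :
    0 ≤ typeWeight q m g k j := by
  have hq' : (3 : ℝ) ≤ q := by exact_mod_cast hq
  have hq1 : 0 < (q : ℝ) - 1 := by linarith
  have hq2 : 0 < (q : ℝ) - 2 := by linarith
  fin_cases j <;> simp only [typeWeight] <;> simp <;> positivity

/-- The number of positions of each joint type. -/
def typeCount {q n : ℕ} (y x : Word q n) (j : Fin 5) : ℕ :=
  (univ.filter fun l => pairType (y l) (x l) = j).card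

/-- Method of types: under the product of these conditional laws every word of joint type `k` with
`y` has the same weight, and the total weight is at most 1. -/
theorem card_of_type_mul_le {q n : ℕ} [NeZero q] (hq : 3 ≤ q) (y : Word q n) (k : Fin 5 → ℕ)
    {m g : ℕ} (hm : k 0 + k 1 = m) (hg : k 2 + k 3 + k 4 = g) :
    ((univ.filter fun x : Word q n => typeCount y x = k).card : ℝ) *
      ∏ j, typeWeight q m g k j ^ k j ≤ 1 := by
  have key : ∀ x ∈ univ.filter fun x : Word q n => typeCount y x = k,
      ∏ j, typeWeight q m g k j ^ k j = ∏ l, typeWeight q m g k (pairType (y l) (x l)) := by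
    intro x hx
    rw [← prod_fiberwise' univ (fun l => pairType (y l) (x l)) (typeWeight q m g k)]
    refine prod_congr rfl fun j _ => ?_
    rw [prod_const, ← (mem_filter.1 hx).2]
    rfl
  calc _ = ∑ x ∈ univ.filter fun x : Word q n => typeCount y x = k,
        ∏ j, typeWeight q m g k j ^ k j := by rw [sum_const, nsmul_eq_mul]
    _ = ∑ x ∈ univ.filter fun x : Word q n => typeCount y x = k,
        ∏ l, typeWeight q m g k (pairType (y l) (x l)) := sum_congr rfl key
    _ ≤ ∑ x : Word q n, ∏ l, typeWeight q m g k (pairType (y l) (x l)) :=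
        sum_le_univ_sum_of_nonneg fun x => prod_nonneg fun l _ => typeWeight_nonneg hq k _
    _ = ∏ l, ∑ a, typeWeight q m g k (pairType (y l) a) := by
        rw [prod_univ_sum, Fintype.piFinset_univ]
    _ ≤ 1 := prod_le_one (fun l _ => sum_nonneg fun a _ => typeWeight_nonneg hq k _)
        fun l _ => sum_typeWeight_le hq k hm hg (y l)

theorem prod_typeWeight_eq {q n : ℕ} (hq : 3 ≤ q) (hn : 0 < n) (k : Fin 5 → ℕ)
    {m g : ℕ} (hm : k 0 + k 1 = m) (hg : k 2 + k 3 + k 4 = g) (hmg : m + g = n) {ω : ℝ}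
    (hω : (k 1 + k 2 + k 4 : ℝ) = ω * n) :
    ∏ j, typeWeight q m g k j ^ k j =
      Real.exp (-(n * natPhi q ω (g / n) (k 1 / n) (k 2 / n))) := by
  have hq' : (3 : ℝ) ≤ q := by exact_mod_cast hq
  have hq1 : 0 < (q : ℝ) - 1 := by linarith
  have hq2 : 0 < (q : ℝ) - 2 := by linarith
  have hn' : (0 : ℝ) < n := by exact_mod_cast hn
  have hmR : (k 0 : ℝ) + k 1 = m := by exact_mod_cast hm
  have hgR : (k 2 : ℝ) + k 3 + k 4 = g := by exact_mod_cast hg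
  have hmgR : (m : ℝ) + g = n := by exact_mod_cast hmg
  have hpos : ∀ a b : ℕ, a ≤ b → 0 < (a : ℝ) / b ∨ a = 0 := by
    intro a b hab
    rcases Nat.eq_zero_or_pos a with h | h
    · exact Or.inr h
    · left
      have : 0 < b := by omega
      positivity
  have hlog : ∀ (a b : ℕ) (c : ℝ), a ≤ b → 0 < c →
      ((a : ℝ) / b / c) ^ a = Real.exp (a * Real.log (a / b) - a * Real.log c) := by
    intro a b c hab hc
    rw [div_pow, pow_eq_exp_mul_log (hpos a b hab), pow_eq_exp_mul_log (Or.inl hc), Real.exp_sub]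
  have hprod : ∏ j, typeWeight q m g k j ^ k j =
      ((k 0 : ℝ) / m) ^ k 0 * ((k 1 : ℝ) / m / ((q : ℝ) - 1)) ^ k 1 * ((k 2 : ℝ) / g) ^ k 2 *
        ((k 3 : ℝ) / g) ^ k 3 * ((k 4 : ℝ) / g / ((q : ℝ) - 2)) ^ k 4 := by
    rw [Fin.prod_univ_five]
    rfl
  rw [hprod, pow_eq_exp_mul_log (hpos (k 0) m (by omega)), hlog _ _ _ (by omega) hq1,
    pow_eq_exp_mul_log (hpos (k 2) g (by omega)), pow_eq_exp_mul_log (hpos (k 3) g (by omega)),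
    hlog _ _ _ (by omega) hq2, ← Real.exp_add, ← Real.exp_add, ← Real.exp_add, ← Real.exp_add]
  congr 1
  rw [natCast_mul_log_div hn (show k 0 ≤ m by omega), natCast_mul_log_div hn (show k 1 ≤ m by omega),
    natCast_mul_log_div hn (show k 2 ≤ g by omega), natCast_mul_log_div hn (show k 3 ≤ g by omega),
    natCast_mul_log_div hn (show k 4 ≤ g by omega)]
  have e0 : 1 - (g : ℝ) / n - k 1 / n = k 0 / n := by
    field_simp; linarith
  have e1 : 1 - (g : ℝ) / n = m / n := by field_simp; linarith
  have e3 : (g : ℝ) / n + k 1 / n - ω = k 3 / n := by field_simp; linarith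
  have e4 : ω - (k 1 : ℝ) / n - k 2 / n = k 4 / n := by field_simp; linarith
  unfold natPhi
  rw [e0, e1, e3, e4]
  have m1 : n * Real.negMulLog ((m : ℝ) / n) = -((k 0 + k 1) * Real.log ((m : ℝ) / n)) := by
    unfold Real.negMulLog; rw [hmR]; field_simp
  have g1 : n * Real.negMulLog ((g : ℝ) / n) = -((k 2 + k 3 + k 4) * Real.log ((g : ℝ) / n)) := by
    unfold Real.negMulLog; rw [hgR]; field_simp
  have c1 : (n : ℝ) * (k 1 / n * Real.log ((q : ℝ) - 1)) = k 1 * Real.log ((q : ℝ) - 1) := by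
    field_simp
  have c4 : (n : ℝ) * (k 4 / n * Real.log ((q : ℝ) - 2)) = k 4 * Real.log ((q : ℝ) - 2) := by
    field_simp
  linear_combination -m1 - g1 + c1 + c4

theorem sum_typeCount {q n : ℕ} (y x : Word q n) : ∑ j, typeCount y x j = n := by
  unfold typeCount
  rw [← card_eq_sum_card_fiberwise fun l _ => mem_coe.2 (mem_univ _), card_univ, Fintype.card_fin]

/-- With γ, α, β equal to the weight of `y`, the count 1 and the count 2, each divided by n, this
identity and the next two express weights and distance; the normalized distance is γ - β + α. -/
theorem typeCount_left {q n : ℕ} (y x : Word q n) :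
    typeCount y x 2 + typeCount y x 3 + typeCount y x 4 = hammingNorm y := by
  unfold typeCount hammingNorm
  simp only [card_filter, ← sum_add_distrib]
  refine sum_congr rfl fun l _ => ?_
  unfold pairType
  split_ifs <;> simp_all

theorem typeCount_right {q n : ℕ} (y x : Word q n) :
    typeCount y x 1 + typeCount y x 2 + typeCount y x 4 = hammingNorm x := by
  unfold typeCount hammingNorm
  simp only [card_filter, ← sum_add_distrib]
  refine sum_congr rfl fun l _ => ?_
  unfold pairType
  split_ifs <;> simp_all

theorem typeCount_dist {q n : ℕ} (y x : Word q n) :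
    typeCount y x 1 + typeCount y x 3 + typeCount y x 4 = hammingDist x y := by
  unfold typeCount hammingDist
  simp only [card_filter, ← sum_add_distrib]
  refine sum_congr rfl fun l _ => ?_
  unfold pairType
  split_ifs <;> simp_all

/-- There are at most (n + 1)² joint types, and each contains at most q^(nφ) words, by the method of
types. -/
theorem card_sphere_close_le {q n w : ℕ} [NeZero q] (hq : 3 ≤ q) (hn : 0 < n) {ω : ℝ}
    (hwω : (w : ℝ) = ω * n) {lo hi δ E : ℝ}
    (hE : ∀ γ α β, PhiDomain ω γ α β → lo ≤ γ → γ ≤ hi → γ - β + α ≤ δ → phi q ω γ α β ≤ E)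
    (y : Word q n) (hlo : n * lo ≤ hammingNorm y) (hhi : hammingNorm y ≤ n * hi) :
    ((univ.filter fun s : Sphere q n w => (hammingDist s.1 y : ℝ) ≤ n * δ).card : ℝ) ≤
      (n + 1) ^ 2 * (q : ℝ) ^ (n * E) := by
  have hq' : (3 : ℝ) ≤ q := by exact_mod_cast hq
  have hq0 : (0 : ℝ) < q := by linarith
  have hn' : (0 : ℝ) < n := by exact_mod_cast hn
  have hlogq : 0 < Real.log q := Real.log_pos (by linarith)
  set A := univ.filter fun s : Sphere q n w => (hammingDist s.1 y : ℝ) ≤ n * δ with hA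
  -- Once n and the weights of both words are fixed, counts 1 and 2 determine the other three. A
  -- nonempty class supplies a point of the domain at which `hE` applies.
  have hfib : ∀ p ∈ range (n + 1) ×ˢ range (n + 1),
      ((A.filter fun s => (typeCount y s.1 1, typeCount y s.1 2) = p).card : ℝ) ≤
        (q : ℝ) ^ (n * E) := by
    rintro p -
    rcases (A.filter fun s => (typeCount y s.1 1, typeCount y s.1 2) = p).eq_empty_or_nonempty
      with h | ⟨s₀, hs₀⟩
    · rw [h, card_empty, Nat.cast_zero]; positivity
    rw [mem_filter, hA, mem_filter] at hs₀
    obtain ⟨⟨-, hd⟩, hp⟩ := hs₀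
    set k := typeCount y s₀.1 with hk
    have k5 := sum_typeCount y s₀.1
    rw [Fin.sum_univ_five, ← hk] at k5
    have kl := typeCount_left y s₀.1
    have kr := typeCount_right y s₀.1
    have kd := typeCount_dist y s₀.1
    rw [s₀.2] at kr
    rw [← hk] at kl kr kd
    have hsub : ((A.filter fun s => (typeCount y s.1 1, typeCount y s.1 2) = p).card : ℝ) ≤
        ((univ.filter fun x : Word q n => typeCount y x = k).card : ℝ) := by
      rw [Nat.cast_le]
      refine card_le_card_of_injOn (fun s => s.1) ?_ Subtype.val_injective.injOn
      intro s hs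
      rw [mem_coe, mem_filter] at hs
      have h12 := hs.2.trans hp.symm
      rw [Prod.mk.injEq] at h12
      have l5 := sum_typeCount y s.1
      rw [Fin.sum_univ_five] at l5
      have ll := typeCount_left y s.1
      have lr := typeCount_right y s.1
      rw [s.2] at lr
      rw [mem_coe, mem_filter]
      refine ⟨mem_univ _, ?_⟩
      funext j
      fin_cases j <;> simp <;> omega
    have hωR : (k 1 + k 2 + k 4 : ℝ) = ω * n := by rw [← hwω, ← kr]; push_cast; ring
    have hmain := card_of_type_mul_le hq y k rfl kl
    have klR : (k 2 : ℝ) + k 3 + k 4 = hammingNorm y := by exact_mod_cast kl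
    have k5R : (k 0 : ℝ) + k 1 + k 2 + k 3 + k 4 = n := by exact_mod_cast k5
    have kdR : (k 1 : ℝ) + k 3 + k 4 = hammingDist s₀.1 y := by exact_mod_cast kd
    rw [prod_typeWeight_eq hq hn k rfl kl (by omega) hωR] at hmain
    have p0 : (0 : ℝ) ≤ k 0 := Nat.cast_nonneg _
    have p1 : (0 : ℝ) ≤ k 1 := Nat.cast_nonneg _
    have p2 : (0 : ℝ) ≤ k 2 := Nat.cast_nonneg _
    have p3 : (0 : ℝ) ≤ k 3 := Nat.cast_nonneg _
    have p4 : (0 : ℝ) ≤ k 4 := Nat.cast_nonneg _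
    have hdom : PhiDomain ω (hammingNorm y / n) (k 1 / n) (k 2 / n) := by
      rw [← klR]
      refine ⟨⟨by positivity, ?_⟩, ⟨by positivity, ?_⟩, ⟨by positivity, ?_⟩, ?_, ?_, ?_, ?_⟩
      · rw [div_le_one hn']; linarith
      · rw [div_le_one hn']; linarith
      · rw [div_le_one hn']; linarith
      · rw [le_sub_iff_add_le, ← add_div, div_le_one hn']; linarith
      · gcongr; linarith
      · rw [← add_div, div_le_iff₀ hn']; linarith
      · rw [sub_le_iff_le_add, ← add_div, le_div_iff₀ hn']; linarith
    have hphi := hE _ _ _ hdom (by rw [le_div_iff₀ hn']; linarith)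
      (by rw [div_le_iff₀ hn']; linarith)
      (by rw [← sub_div, ← add_div, div_le_iff₀ hn']; linarith)
    rw [phi_eq_natPhi hq hdom, div_le_iff₀ hlogq] at hphi
    refine hsub.trans ?_
    rw [Real.exp_neg, ← div_eq_mul_inv, div_le_one (Real.exp_pos _)] at hmain
    refine hmain.trans ?_
    rw [Real.rpow_def_of_pos hq0, Real.exp_le_exp]
    nlinarith
  have hmaps : (A : Set (Sphere q n w)).MapsTo (fun s => (typeCount y s.1 1, typeCount y s.1 2))
      (range (n + 1) ×ˢ range (n + 1) : Finset (ℕ × ℕ)) := by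
    intro s _
    have l5 := sum_typeCount y s.1
    rw [Fin.sum_univ_five] at l5
    simp only [coe_product, coe_range, Set.mem_prod, Set.mem_Iio]
    omega
  rw [card_eq_sum_card_fiberwise hmaps, Nat.cast_sum]
  refine (sum_le_sum hfib).trans ?_
  rw [sum_const, card_product, card_range, nsmul_eq_mul]
  push_cast
  rw [sq]

/-! ### Concentration for the random construction -/

/-- Offsets outside `U` integrate out. Each remaining uniform offset is replaced by a product law at
the cost of a factor n + 1, and words off the sphere only add nonnegative terms. -/
theorem expect_choice_le {q n M₁ M₂ w : ℕ} [NeZero q] (hq : 3 ≤ q) (hw : w ≤ n) {ω : ℝ}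
    (hω : ω ∈ Set.Icc (0 : ℝ) 1) (hwω : (w : ℝ) = ω * n) (U : Finset (User M₁ M₂))
    (F : (Fin M₁ → Word q n) → (U → Word q n) → ℝ) (hF : ∀ r s, 0 ≤ F r s) :
    𝔼 k : Choice q n M₁ M₂ w, F k.1 (fun u => (k.2 u.1.1 u.1.2).1) ≤
      (n + 1) ^ U.card * 𝔼 r : Fin M₁ → Word q n, ∑ s : U → Word q n,
        (∏ u, ∏ l, letterProb q ω (s u l)) * F r s := by
  classical
  have hne : Nonempty (Sphere q n w) := sphere_nonempty (by omega) hw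
  rw [← univ_product_univ, expect_product, mul_expect]
  refine expect_le_expect fun r _ => ?_
  have hmarg : 𝔼 S : Fin M₁ → Fin M₂ → Sphere q n w, F r (fun u : U => (S u.1.1 u.1.2).1) =
      𝔼 s : U → Sphere q n w, F r (fun u => (s u).1) := by
    refine (Fintype.expect_equiv ((Equiv.curry (Fin M₁) (Fin M₂) (Sphere q n w)).symm.trans
      (Equiv.piEquivPiSubtypeProd (· ∈ U) fun _ => Sphere q n w)) _
      (fun p : (U → Sphere q n w) × ({u // u ∉ U} → Sphere q n w) => F r (fun u => (p.1 u).1))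
      fun S => rfl).trans ?_
    rw [← univ_product_univ, expect_product]
    simp only [Fintype.expect_const]
  rw [hmarg, Fintype.expect_eq_sum_div_card, sum_div, mul_sum]
  have hinj : Function.Injective fun (s : U → Sphere q n w) (u : U) => (s u).1 := by
    intro s s' h
    funext u
    exact Subtype.ext (congrFun h u)
  have hnn : ∀ s : U → Word q n, 0 ≤ ((n : ℝ) + 1) ^ U.card *
      ((∏ u, ∏ l, letterProb q ω (s u l)) * F r s) := fun s =>
    mul_nonneg (by positivity) (mul_nonneg
      (prod_nonneg fun u _ => prod_nonneg fun l _ => letterProb_nonneg hq hω _) (hF _ _))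
  refine le_trans (sum_le_sum fun s _ => ?_) (le_trans (sum_map univ ⟨_, hinj⟩ fun s : U → Word q n =>
    ((n : ℝ) + 1) ^ U.card * ((∏ u, ∏ l, letterProb q ω (s u l)) * F r s)).ge
    (sum_le_univ_sum_of_nonneg hnn))
  have hone : 1 / (Fintype.card (U → Sphere q n w) : ℝ) ≤
      ((n : ℝ) + 1) ^ U.card * ∏ u, ∏ l, letterProb q ω ((s u).1 l) := by
    calc 1 / (Fintype.card (U → Sphere q n w) : ℝ)
        = ∏ u : U, (1 / (Fintype.card (Sphere q n w) : ℝ)) := by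
          rw [Fintype.card_fun, prod_const, card_univ]
          push_cast
          rw [one_div_pow]
      _ ≤ ∏ u : U, ((n + 1) * ∏ l, letterProb q ω ((s u).1 l)) :=
          prod_le_prod (fun _ _ => by positivity) fun u _ => one_div_card_sphere_le hq hw hwω (s u)
      _ = _ := by rw [prod_mul_distrib, prod_const, card_univ, Fintype.card_coe]
  rw [div_eq_mul_one_div, mul_comm, ← mul_assoc]
  exact mul_le_mul_of_nonneg_right hone (hF _ _)

/-- The probability of an event that concerns the letters of all centers and of the offsets of
the users in `U` at one coordinate, when the letters of the offsets are independent. -/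
noncomputable def colProb (q : ℕ) [NeZero q] (ω : ℝ) {M₁ M₂ : ℕ} (U : Finset (User M₁ M₂))
    (P : (Fin M₁ → ZMod q) → (U → ZMod q) → Prop) : ℝ :=
  𝔼 c : Fin M₁ → ZMod q, ∑ d : U → ZMod q, (∏ u, letterProb q ω (d u)) * ind (P c d)

open Classical in
/-- The number of coordinates at which the event `P` occurs. -/
noncomputable def colCount {q n M₁ M₂ w : ℕ} (U : Finset (User M₁ M₂))
    (P : (Fin M₁ → ZMod q) → (U → ZMod q) → Prop) (k : Choice q n M₁ M₂ w) : ℕ :=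
  (univ.filter fun l => P (fun i => k.1 i l) (fun u => (k.2 u.1.1 u.1.2).1 l)).card

/-- After the change to the product law, the experiment read by columns consists of n independent
identical draws, to which the exponential bound applies. -/
theorem expect_colCount_le {q n M₁ M₂ w : ℕ} [NeZero q] (hq : 3 ≤ q) (hw : w ≤ n) {ω : ℝ}
    (hω : ω ∈ Set.Icc (0 : ℝ) 1) (hwω : (w : ℝ) = ω * n) (U : Finset (User M₁ M₂))
    (P : (Fin M₁ → ZMod q) → (U → ZMod q) → Prop) {μ η : ℝ} (hμ : μ ≤ colProb q ω U P)
    (hη : 0 ≤ η) (hη1 : η ≤ 1) :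
    𝔼 k : Choice q n M₁ M₂ w, ind ((colCount U P k : ℝ) ≤ n * (μ - η)) ≤
      (n + 1) ^ U.card * Real.exp (-(n * η ^ 2 / 4)) := by
  classical
  let P₀ : (Fin M₁ → ZMod q) × (U → ZMod q) → ℝ := fun a =>
    1 / (Fintype.card (Fin M₁ → ZMod q) : ℝ) * ∏ u, letterProb q ω (a.2 u)
  have hsum : ∀ G : (Fin M₁ → ZMod q) × (U → ZMod q) → ℝ, ∑ a, P₀ a * G a =
      𝔼 c, ∑ d, (∏ u, letterProb q ω (d u)) * G (c, d) := by
    intro G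
    rw [Fintype.sum_prod_type, Fintype.expect_eq_sum_div_card, sum_div]
    refine sum_congr rfl fun c _ => ?_
    rw [sum_div]
    refine sum_congr rfl fun d _ => ?_
    simp only [P₀]
    ring
  have hP₀ : ∀ a, 0 ≤ P₀ a := fun a =>
    mul_nonneg (by positivity) (prod_nonneg fun u _ => letterProb_nonneg hq hω _)
  have hP₁ : ∑ a, P₀ a = 1 := by
    have := hsum fun _ => 1
    simp only [mul_one] at this
    rw [this]
    have h1 : ∑ d : U → ZMod q, ∏ u, letterProb q ω (d u) = 1 := by
      rw [← Fintype.piFinset_univ, ← prod_univ_sum (fun _ => univ) fun _ a => letterProb q ω a]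
      simp [sum_letterProb hq]
    rw [h1, Fintype.expect_const]
  have hmain := sum_prod_ind_le_exp n P₀ hP₀ hP₁ (fun a => ind (P a.1 a.2))
    (fun a => ⟨ind_nonneg _, ind_le_one _⟩) μ η (by rw [hsum]; exact hμ) hη hη1
  refine (expect_choice_le hq hw hω hwω U (fun r s => ind (((univ.filter fun l =>
    P (fun i => r i l) (fun u => s u l)).card : ℝ) ≤ n * (μ - η))) fun _ _ => ind_nonneg _).trans ?_
  refine mul_le_mul_of_nonneg_left (le_trans (le_of_eq ?_) hmain) (by positivity)
  let e : (Fin M₁ → Word q n) × (U → Word q n) ≃ (Fin n → (Fin M₁ → ZMod q) × (U → ZMod q)) :=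
    { toFun := fun p l => (fun i => p.1 i l, fun u => p.2 u l)
      invFun := fun z => (fun i l => (z l).1 i, fun u l => (z l).2 u)
      left_inv := fun _ => rfl
      right_inv := fun _ => rfl }
  rw [← e.sum_comp, Fintype.sum_prod_type, Fintype.expect_eq_sum_div_card, sum_div]
  refine sum_congr rfl fun r _ => ?_
  rw [sum_div]
  refine sum_congr rfl fun s _ => ?_
  have h1 : ∏ l, P₀ (e (r, s) l) = (∏ u, ∏ l, letterProb q ω (s u l)) /
      (Fintype.card (Fin M₁ → Word q n) : ℝ) := by
    simp only [P₀]
    rw [prod_mul_distrib, Finset.prod_comm, prod_const, card_univ, Fintype.card_fin, one_div_pow,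
      one_div_mul_eq_div]
    congr 1
    simp only [Fintype.card_fun, Fintype.card_fin]
    push_cast
    rw [← pow_mul, ← pow_mul, mul_comm]
  have h2 : ∑ l, ind (P (e (r, s) l).1 (e (r, s) l).2) = ((univ.filter fun l =>
      P (fun i => r i l) (fun u => s u l)).card : ℝ) :=
    sum_ind_eq_card univ fun l => P (fun i => r i l) (fun u => s u l)
  rw [h1, h2, div_mul_eq_mul_div]

/-! ### One-coordinate probabilities -/

theorem expect_prod_eq {ι A : Type*} [Fintype ι] [DecidableEq ι] [Fintype A]
    (g : ι → A → ℝ) : 𝔼 c : ι → A, ∏ i, g i (c i) = ∏ i, 𝔼 a, g i a := by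
  simp only [Fintype.expect_eq_sum_div_card]
  rw [prod_div_distrib, prod_univ_sum, Fintype.piFinset_univ, Fintype.card_fun, prod_const,
    card_univ]
  push_cast
  rfl

/-- Power mean inequality: the average of `p` over the alphabet is 1/q. -/
theorem inv_pow_le_expect_pow {q : ℕ} [NeZero q] (p : ZMod q → ℝ) (hp : ∀ x, 0 ≤ p x)
    (hp1 : ∑ x, p x = 1) (m : ℕ) : ((q : ℝ)⁻¹) ^ m ≤ 𝔼 x, p x ^ m := by
  rcases m with _ | m
  · simp
  have h := pow_sum_div_card_le_sum_pow (s := univ) (f := p) (fun x _ => hp x) m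
  rw [hp1, one_pow, card_univ, ZMod.card] at h
  rw [Fintype.expect_eq_sum_div_card, ZMod.card, inv_pow, pow_succ, mul_inv, ← div_eq_mul_inv,
    ← one_div]
  gcongr

/-- The letters of `m` users agree with probability at least `q^{1-m}`. -/
theorem colProb_agree {q M₁ M₂ : ℕ} [NeZero q] (hq : 3 ≤ q) {ω : ℝ}
    (hω : ω ∈ Set.Icc (0 : ℝ) 1) (U : Finset (User M₁ M₂)) (hU : U.Nonempty) :
    q * ((q : ℝ)⁻¹) ^ U.card ≤ colProb q ω U fun c d => ∃ a, ∀ u, c u.1.1 + d u = a := by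
  classical
  obtain ⟨u₀, hu₀⟩ := hU
  have h1 : ∀ (c : Fin M₁ → ZMod q) (d : U → ZMod q), ind (∃ a, ∀ u, c u.1.1 + d u = a) =
      ∑ a, ∏ u, ind (d u = a - c u.1.1) := by
    intro c d
    simp only [prod_ind_eq, mem_univ, true_implies, eq_sub_iff_add_eq']
    by_cases h : ∃ a, ∀ u, c u.1.1 + d u = a
    · rw [ind_of h]
      obtain ⟨a, ha⟩ := h
      rw [sum_eq_single a, ind_of ha]
      · intro b _ hb
        exact ind_of_not fun h' => hb ((h' ⟨u₀, hu₀⟩).symm.trans (ha ⟨u₀, hu₀⟩))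
      · intro h; exact absurd (mem_univ a) h
    · rw [ind_of_not h, sum_eq_zero]
      intro a _
      exact ind_of_not fun h' => h ⟨a, h'⟩
  have h2 : ∀ (c : Fin M₁ → ZMod q) (a : ZMod q), ∑ d : U → ZMod q,
      (∏ u, letterProb q ω (d u)) * ∏ u, ind (d u = a - c u.1.1) =
        ∏ u : U, letterProb q ω (a - c u.1.1) := by
    intro c a
    simp only [← prod_mul_distrib]
    rw [← Fintype.piFinset_univ, ← prod_univ_sum (fun _ => univ)
      fun (u : U) x => letterProb q ω x * ind (x = a - c u.1.1)]
    refine prod_congr rfl fun u _ => ?_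
    simp only [mul_comm (letterProb q ω _)]
    exact sum_ind_eq_mul _ _
  -- Each of the q possible common letters contributes equally, by the reflection c ↦ a - c of the
  -- uniform centers. The centers then factorize over groups, each to the power of its number of
  -- pirates.
  have h3 : colProb q ω U (fun c d => ∃ a, ∀ u, c u.1.1 + d u = a) =
      q * 𝔼 c : Fin M₁ → ZMod q, ∏ u : U, letterProb q ω (c u.1.1) := by
    unfold colProb
    simp only [h1, mul_sum]
    simp only [sum_comm (s := (univ : Finset (U → ZMod q))), h2]
    rw [expect_sum_comm]
    have : ∀ a ∈ (univ : Finset (ZMod q)),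
        𝔼 c : Fin M₁ → ZMod q, ∏ u : U, letterProb q ω (a - c u.1.1) =
        𝔼 c : Fin M₁ → ZMod q, ∏ u : U, letterProb q ω (c u.1.1) := fun a _ =>
      Fintype.expect_equiv (Equiv.subLeft fun _ => a) _ _ fun c => rfl
    rw [sum_congr rfl this, sum_const, card_univ, ZMod.card, nsmul_eq_mul]
  rw [h3]
  refine mul_le_mul_of_nonneg_left ?_ (Nat.cast_nonneg q)
  have h4 : ∀ c : Fin M₁ → ZMod q, ∏ u : U, letterProb q ω (c u.1.1) =
      ∏ i, letterProb q ω (c i) ^ (univ.filter fun u : U => u.1.1 = i).card := by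
    intro c
    rw [← prod_fiberwise' univ (fun u : U => u.1.1) fun i => letterProb q ω (c i)]
    simp only [prod_const]
  simp only [h4]
  rw [expect_prod_eq fun i x => letterProb q ω x ^ (univ.filter fun u : U => u.1.1 = i).card]
  have h5 : ∑ i, (univ.filter fun u : U => u.1.1 = i).card = U.card := by
    rw [← card_eq_sum_card_fiberwise fun u _ => mem_coe.2 (mem_univ _), card_univ,
      Fintype.card_coe]
  rw [← h5, ← prod_pow_eq_pow_sum]
  exact prod_le_prod (fun i _ => by positivity) fun i _ =>
    inv_pow_le_expect_pow _ (letterProb_nonneg hq hω) (sum_letterProb hq ω) _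

theorem sum_prod_mul_pair {ι A : Type*} [Fintype ι] [DecidableEq ι] [Fintype A] (p : A → ℝ)
    (hp1 : ∑ x, p x = 1) {i j : ι} (hij : i ≠ j) (H : A → A → ℝ) :
    ∑ d : ι → A, (∏ u, p (d u)) * H (d i) (d j) = ∑ x, ∑ y, p x * p y * H x y := by
  classical
  have h1 : ∀ (x y : A), ∑ d : ι → A, (∏ u, p (d u)) * (ind (d i = x) * ind (d j = y)) =
      p x * p y := by
    intro x y
    let g : ι → A → ℝ := fun u a =>
      p a * ((if u = i then ind (a = x) else 1) * (if u = j then ind (a = y) else 1))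
    have h2 : ∀ d : ι → A, (∏ u, p (d u)) * (ind (d i = x) * ind (d j = y)) =
        ∏ u, g u (d u) := by
      intro d
      simp only [g]
      rw [prod_mul_distrib, prod_mul_distrib, prod_ite_eq' univ i, prod_ite_eq' univ j,
        if_pos (mem_univ _), if_pos (mem_univ _)]
    simp only [h2]
    rw [← Fintype.piFinset_univ, ← prod_univ_sum (fun _ => univ) g]
    have hgi : ∑ a, g i a = p x := by
      simp only [g, if_neg hij, if_pos, mul_one, mul_comm (p _)]
      exact sum_ind_eq_mul _ _
    have hgj : ∑ a, g j a = p y := by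
      simp only [g, if_neg hij.symm, if_pos, one_mul, mul_comm (p _)]
      exact sum_ind_eq_mul _ _
    rw [← mul_prod_erase univ _ (mem_univ i), hgi,
      ← mul_prod_erase (univ.erase i) _ (mem_erase.2 ⟨hij.symm, mem_univ j⟩), hgj, prod_eq_one,
      mul_one]
    intro u hu
    rw [mem_erase, mem_erase] at hu
    simp only [g, if_neg hu.1, if_neg hu.2.1, mul_one]
    exact hp1
  have h3 : ∀ d : ι → A, H (d i) (d j) = ∑ x, ∑ y, ind (d i = x) * ind (d j = y) * H x y := by
    intro d
    simp only [mul_assoc, ← mul_sum, eq_comm (a := d i), eq_comm (a := d j)]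
    rw [sum_ind_eq_mul (d i) fun x => ∑ y, ind (y = d j) * H x y, sum_ind_eq_mul]
  simp only [h3, mul_sum]
  rw [sum_comm]
  refine sum_congr rfl fun x _ => ?_
  rw [sum_comm]
  refine sum_congr rfl fun y _ => ?_
  rw [← h1, sum_mul]
  refine sum_congr rfl fun d _ => ?_
  ring

theorem colProb_pair {q M₁ M₂ : ℕ} [NeZero q] (hq : 3 ≤ q) (ω : ℝ) {U : Finset (User M₁ M₂)}
    {u₀ u₁ : U} (hu : u₀ ≠ u₁) (P : (Fin M₁ → ZMod q) → ZMod q → ZMod q → Prop) :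
    colProb q ω U (fun c d => P c (d u₀) (d u₁)) =
      ∑ x, ∑ y, letterProb q ω x * letterProb q ω y * 𝔼 c : Fin M₁ → ZMod q, ind (P c x y) := by
  classical
  unfold colProb
  have h : ∀ c : Fin M₁ → ZMod q, ∑ d : U → ZMod q, (∏ u, letterProb q ω (d u)) *
      ind (P c (d u₀) (d u₁)) = ∑ x, ∑ y, letterProb q ω x * letterProb q ω y * ind (P c x y) :=
    fun c => sum_prod_mul_pair _ (sum_letterProb hq ω) hu fun x y => ind (P c x y)
  simp only [h]
  rw [expect_sum_comm]
  refine sum_congr rfl fun x _ => ?_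
  rw [expect_sum_comm]
  refine sum_congr rfl fun y _ => ?_
  rw [mul_expect]

theorem expect_ind_eq {q : ℕ} [NeZero q] (a : ZMod q) :
    𝔼 x : ZMod q, ind (x = a) = 1 / (q : ℝ) := by
  rw [Fintype.expect_eq_sum_div_card, ZMod.card]
  have := sum_ind_eq_mul a fun _ => (1 : ℝ)
  simp only [mul_one] at this
  rw [this]

theorem expect_update {ι A : Type*} [Fintype ι] [DecidableEq ι] [Fintype A] [Nonempty A] (i : ι)
    (F : (ι → A) → ℝ) : 𝔼 c, F c = 𝔼 c, 𝔼 a, F (Function.update c i a) :=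
  expect_eq_expect_resample (fun c => c i) (fun c a => Function.update c i a) (by simp) (by simp) F

/-- The center of the second group is uniform and independent of the first, so the relative letter
is uniform. -/
theorem expect_ind_relative_eq {q M : ℕ} [NeZero q] {i₀ i₁ : Fin M} (h : i₀ ≠ i₁)
    (y a : ZMod q) : 𝔼 c : Fin M → ZMod q, ind (c i₁ + y - c i₀ = a) = 1 / (q : ℝ) := by
  rw [expect_update i₁]
  simp only [Function.update_self, Function.update_of_ne h]
  have : ∀ (c : Fin M → ZMod q) (x : ZMod q), x + y - c i₀ = a ↔ x = a + c i₀ - y := by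
    intro c x
    constructor <;> intro h
    · rw [← h]; ring
    · rw [h]; ring
  simp only [this, expect_ind_eq]
  rw [Fintype.expect_const]

theorem sum_letterProb_mul_ind_zero {q : ℕ} [NeZero q] (ω : ℝ) :
    ∑ x : ZMod q, letterProb q ω x * ind (x = 0) = 1 - ω := by
  simp only [mul_comm (letterProb q ω _)]
  rw [sum_ind_eq_mul]
  simp [letterProb]

theorem sum_letterProb_mul_ind_ne_zero {q : ℕ} [NeZero q] (hq : 3 ≤ q) (ω : ℝ) :
    ∑ x : ZMod q, letterProb q ω x * ind (x ≠ 0) = ω := by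
  simp only [ne_eq, ind_not, mul_sub, mul_one]
  rw [sum_sub_distrib, sum_letterProb hq, sum_letterProb_mul_ind_zero]
  ring

theorem sum_sum_mul_mul_mul {A : Type*} [Fintype A] (p f g : A → ℝ) :
    ∑ x, ∑ y, p x * p y * (f x * g y) = (∑ x, p x * f x) * ∑ y, p y * g y := by
  rw [sum_mul_sum]
  refine sum_congr rfl fun x _ => sum_congr rfl fun y _ => ?_
  ring

/-- The joint behaviour of the offset of a user and of the fingerprint of another user relative
to the center of the first, at one coordinate. -/
theorem colProb_same_group {q M₁ M₂ : ℕ} [NeZero q] (hq : 3 ≤ q) (ω : ℝ)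
    {U : Finset (User M₁ M₂)} {u₀ u₁ : U} (hu : u₀ ≠ u₁) (hg : u₀.1.1 = u₁.1.1) :
    colProb q ω U (fun c d => d u₀ ≠ 0 ∧ c u₁.1.1 + d u₁ - c u₀.1.1 ≠ 0) = ω ^ 2 ∧
    colProb q ω U (fun c d => d u₀ = 0 ∧ c u₁.1.1 + d u₁ - c u₀.1.1 = 0) = (1 - ω) ^ 2 ∧
    colProb q ω U (fun c d => c u₁.1.1 + d u₁ - c u₀.1.1 = d u₀) =
      (1 - ω) ^ 2 + ω ^ 2 / ((q : ℝ) - 1) := by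
  have hq' : (3 : ℝ) ≤ q := by exact_mod_cast hq
  have hq1 : (q : ℝ) - 1 ≠ 0 := by linarith
  -- The common center cancels, leaving two independent offset letters.
  simp only [hg, add_sub_cancel_left]
  refine ⟨?_, ?_, ?_⟩
  · rw [colProb_pair hq ω hu fun _ x y => x ≠ 0 ∧ y ≠ 0]
    simp only [Fintype.expect_const, ind_and]
    rw [sum_sum_mul_mul_mul, sum_letterProb_mul_ind_ne_zero hq, sq]
  · rw [colProb_pair hq ω hu fun _ x y => x = 0 ∧ y = 0]
    simp only [Fintype.expect_const, ind_and]
    rw [sum_sum_mul_mul_mul, sum_letterProb_mul_ind_zero, sq]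
  · rw [colProb_pair hq ω hu fun _ x y => y = x]
    simp only [Fintype.expect_const, mul_comm _ (ind _), sum_ind_eq_mul]
    have : ∀ x : ZMod q, letterProb q ω x * letterProb q ω x =
        if x = 0 then (1 - ω) ^ 2 else (ω / ((q : ℝ) - 1)) ^ 2 := by
      intro x
      unfold letterProb
      split_ifs <;> ring
    simp only [this]
    rw [sum_letter]
    field_simp

theorem colProb_different_group {q M₁ M₂ : ℕ} [NeZero q] (hq : 3 ≤ q) (ω : ℝ)
    {U : Finset (User M₁ M₂)} {u₀ u₁ : U} (hg : u₀.1.1 ≠ u₁.1.1) :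
    colProb q ω U (fun c d => d u₀ ≠ 0 ∧ c u₁.1.1 + d u₁ - c u₀.1.1 ≠ 0) =
      ω * (((q : ℝ) - 1) / q) ∧
    colProb q ω U (fun c d => d u₀ = 0 ∧ c u₁.1.1 + d u₁ - c u₀.1.1 = 0) = (1 - ω) / q ∧
    colProb q ω U (fun c d => c u₁.1.1 + d u₁ - c u₀.1.1 = d u₀) = 1 / q := by
  have hu : u₀ ≠ u₁ := fun h => hg (by rw [h])
  have hq' : (3 : ℝ) ≤ q := by exact_mod_cast hq
  have hq0 : (q : ℝ) ≠ 0 := by linarith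
  have hsum := sum_letterProb hq ω
  refine ⟨?_, ?_, ?_⟩
  · rw [colProb_pair hq ω hu fun c x y => x ≠ 0 ∧ c u₁.1.1 + y - c u₀.1.1 ≠ 0]
    simp only [ind_and, ← mul_expect, ne_eq, ind_not (_ + _ - _ = _), expect_sub_distrib,
      Fintype.expect_const, expect_ind_relative_eq hg]
    rw [sum_sum_mul_mul_mul _ _ fun _ => 1 - 1 / (q : ℝ), ← sum_mul, hsum]
    have := sum_letterProb_mul_ind_ne_zero hq ω
    simp only [ne_eq] at this
    rw [this]
    field_simp
  · rw [colProb_pair hq ω hu fun c x y => x = 0 ∧ c u₁.1.1 + y - c u₀.1.1 = 0]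
    simp only [ind_and, ← mul_expect, expect_ind_relative_eq hg]
    rw [sum_sum_mul_mul_mul _ _ fun _ => 1 / (q : ℝ), ← sum_mul, hsum,
      sum_letterProb_mul_ind_zero]
    ring
  · rw [colProb_pair hq ω hu fun c x y => c u₁.1.1 + y - c u₀.1.1 = x]
    simp only [expect_ind_relative_eq hg]
    simp only [← sum_mul, ← mul_sum, hsum, mul_one, one_mul]

/-! ### Error probabilities of the construction -/

theorem e₁_construction {q n M₁ M₂ w : ℕ} [NeZero q] (hq : 2 ≤ q) (hw : w ≤ n)
    (D : Choice q n M₁ M₂ w → Word q n → User M₁ M₂) (U : Finset (User M₁ M₂))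
    (V : Strategy q n U) :
    (construction q n M₁ M₂ w hq hw D).e₁ U V = 𝔼 k : Choice q n M₁ M₂ w,
      ∑ y, V.prob (fun u => fingerprint k u) y * ind (∀ u ∈ U, (D k y).1 ≠ u.1) := by
  rw [Fintype.expect_eq_sum_div_card, sum_div]
  refine sum_congr rfl fun k _ => ?_
  rw [div_eq_mul_one_div, mul_comm]
  refine congrArg (· * _) ?_
  rw [sum_filter]
  refine sum_congr rfl fun y _ => ?_
  simp [construction, ind]

theorem e₂_construction {q n M₁ M₂ w : ℕ} [NeZero q] (hq : 2 ≤ q) (hw : w ≤ n)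
    (D : Choice q n M₁ M₂ w → Word q n → User M₁ M₂) (U : Finset (User M₁ M₂))
    (V : Strategy q n U) :
    (construction q n M₁ M₂ w hq hw D).e₂ U V = 𝔼 k : Choice q n M₁ M₂ w,
      ∑ y, V.prob (fun u => fingerprint k u) y * ind (D k y ∉ U) := by
  rw [Fintype.expect_eq_sum_div_card, sum_div]
  refine sum_congr rfl fun k _ => ?_
  rw [div_eq_mul_one_div, mul_comm]
  refine congrArg (· * _) ?_
  rw [sum_filter]
  refine sum_congr rfl fun y _ => ?_
  have : (∀ u ∈ U, some (D k y) ≠ some u) ↔ D k y ∉ U := by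
    simp only [ne_eq, Option.some.injEq]
    exact ⟨fun h hm => h _ hm rfl, fun h u hu he => h (he ▸ hu)⟩
  simp only [construction, ind, this, mul_ite, mul_one, mul_zero]

/-- Union bound in which the exceptional event `A` depends on the key alone. Only forgeries of
nonzero probability matter, which is where admissibility enters later. -/
theorem expect_response_le_add {K X Y J : Type*} [Fintype K] [Fintype Y] (obs : K → X)
    (V : X → Y → ℝ) (hV : ∀ x y, 0 ≤ V x y) (hV1 : ∀ x, ∑ y, V x y = 1) (E : K → Y → Prop)
    (A : K → Prop) (T : Finset J) (E' : J → K → Y → Prop)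
    (h : ∀ k y, V (obs k) y ≠ 0 → E k y → A k ∨ ∃ j ∈ T, E' j k y) :
    𝔼 k, ∑ y, V (obs k) y * ind (E k y) ≤
      𝔼 k, ind (A k) + ∑ j ∈ T, 𝔼 k, ∑ y, V (obs k) y * ind (E' j k y) := by
  rw [← expect_sum_comm, ← expect_add_distrib]
  refine expect_le_expect fun k _ => ?_
  have e : ind (A k) = ∑ y, V (obs k) y * ind (A k) := by rw [← sum_mul, hV1, one_mul]
  rw [e, sum_comm, ← sum_add_distrib]
  refine sum_le_sum fun y _ => ?_
  rw [← mul_sum, ← mul_add]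
  by_cases h0 : V (obs k) y = 0
  · simp [h0]
  refine mul_le_mul_of_nonneg_left ?_ (hV _ _)
  calc ind (E k y) ≤ ind (A k ∨ ∃ j ∈ T, E' j k y) := ind_mono (h k y h0)
    _ ≤ ind (A k) + ind (∃ j ∈ T, E' j k y) := ind_or_le _ _
    _ ≤ _ := by gcongr; exact ind_exists_le _ _

theorem expect_response_le_one {K X Y : Type*} [Fintype K] [Nonempty K] [Fintype Y] (obs : K → X)
    (V : X → Y → ℝ) (hV : ∀ x y, 0 ≤ V x y) (hV1 : ∀ x, ∑ y, V x y = 1) (E : K → Y → Prop) :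
    𝔼 k, ∑ y, V (obs k) y * ind (E k y) ≤ 1 := by
  refine (expect_le_expect (g := fun _ => (1 : ℝ)) fun k _ => ?_).trans
    (Fintype.expect_const _).le
  rw [← hV1 (obs k)]
  exact sum_le_sum fun y _ => mul_le_of_le_one_right (hV _ _) (ind_le_one _)

theorem nonempty_choice {q n M₁ M₂ w : ℕ} [NeZero q] (hq : 3 ≤ q) (hw : w ≤ n) :
    Nonempty (Choice q n M₁ M₂ w) := by
  have := sphere_nonempty (q := q) (by omega) hw
  infer_instance

/-- Among the `m` members of a coalition, the total distance to a forgery is small when they agree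
at many coordinates. -/
theorem sum_hammingDist_le {q n : ℕ} {ι : Type} [Fintype ι] (x : ι → Word q n) (y : Word q n)
    (hy : y ∈ envelope x) (Z : Finset (Fin n)) (hZ : ∀ l ∈ Z, ∃ a, ∀ i, x i l = a) :
    ∑ i, (hammingDist (x i) y : ℝ) ≤ ((Fintype.card ι : ℝ) - 1) * (n - Z.card) := by
  classical
  have h1 : ∀ l, ∑ i, ind (x i l ≠ y l) ≤ ((Fintype.card ι : ℝ) - 1) * (1 - ind (l ∈ Z)) := by
    intro l
    obtain ⟨i₀, hi₀⟩ := hy l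
    by_cases hl : l ∈ Z
    · obtain ⟨a, ha⟩ := hZ l hl
      rw [ind_of hl, sub_self, mul_zero, sum_eq_zero]
      intro i _
      exact ind_of_not fun h => h (by rw [hi₀, ha i, ha i₀])
    · rw [ind_of_not hl, sub_zero, mul_one, ← add_sum_erase _ _ (mem_univ i₀),
        ind_of_not (fun h => h hi₀.symm), zero_add]
      calc ∑ i ∈ univ.erase i₀, ind (x i l ≠ y l) ≤ ∑ i ∈ univ.erase i₀, (1 : ℝ) :=
            sum_le_sum fun i _ => ind_le_one _
        _ = _ := by
          have : 1 ≤ Fintype.card ι := Fintype.card_pos_iff.2 ⟨i₀⟩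
          rw [sum_const, card_erase_of_mem (mem_univ _), card_univ, nsmul_eq_mul, mul_one,
            Nat.cast_sub this, Nat.cast_one]
  calc ∑ i, (hammingDist (x i) y : ℝ) = ∑ l, ∑ i, ind (x i l ≠ y l) := by
        rw [sum_comm]
        refine sum_congr rfl fun i _ => ?_
        rw [sum_ind_eq_card]
        rfl
    _ ≤ ∑ l, ((Fintype.card ι : ℝ) - 1) * (1 - ind (l ∈ Z)) := sum_le_sum fun l _ => h1 l
    _ = _ := by
        rw [← mul_sum, sum_sub_distrib, sum_ind_eq_card]
        simp

/-- The probability that the closest user belongs to an innocent group. -/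
theorem group_error_le {q n M₁ M₂ w t : ℕ} [NeZero q] (hq : 3 ≤ q) (ht : 2 < t) (hw : w ≤ n)
    {ω : ℝ} (hω : ω ∈ Set.Icc (0 : ℝ) 1) (hwω : (w : ℝ) = ω * n)
    {D : Choice q n M₁ M₂ w → Word q n → User M₁ M₂} (hD : IsMDDecoder D)
    {U : Finset (User M₁ M₂)} (hU : U.Nonempty) (hUt : U.card ≤ t) (V : Strategy q n U)
    (hV : V.Admissible) {η ρ : ℝ} (hη : 0 < η) (hη1 : η ≤ 1)
    (hρ : ρ = ((t : ℝ) - 1) / t * (1 - 1 / (q : ℝ) ^ (t - 1)) + ω + η)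
    (hρq : ρ ≤ ((q : ℝ) - 1) / q) :
    𝔼 k : Choice q n M₁ M₂ w,
      ∑ y, V.prob (fun u => fingerprint k u) y * ind (∀ u ∈ U, (D k y).1 ≠ u.1) ≤
      (n + 1) ^ t * Real.exp (-(n * η ^ 2 / 4)) + M₁ * (q : ℝ) ^ (n * (entropy q ρ - 1)) := by
  classical
  have hne := nonempty_choice (M₁ := M₁) (M₂ := M₂) hq hw
  have hq' : (3 : ℝ) ≤ q := by exact_mod_cast hq
  have hq0 : (0 : ℝ) < q := by linarith
  have ht' : (3 : ℝ) ≤ t := by exact_mod_cast ht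
  have ht0 : (0 : ℝ) < t := by linarith
  set μ := 1 / (q : ℝ) ^ (t - 1) with hμ
  have hμ1 : μ ≤ 1 := by
    rw [hμ, div_le_one (by positivity)]
    exact one_le_pow₀ (by linarith)
  have hfrac : 0 ≤ ((t : ℝ) - 1) / t := div_nonneg (by linarith) ht0.le
  have hfrac1 : ((t : ℝ) - 1) / t ≤ 1 := by rw [div_le_one ht0]; linarith
  have hρ0 : 0 < ρ := by
    have := mul_nonneg hfrac (sub_nonneg.2 hμ1)
    have := hω.1
    linarith
  let P : (Fin M₁ → ZMod q) → (U → ZMod q) → Prop := fun c d => ∃ a, ∀ u, c u.1.1 + d u = a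
  have hμP : μ ≤ colProb q ω U P := by
    refine le_trans ?_ (colProb_agree hq hω U hU)
    calc μ = q * ((q : ℝ)⁻¹) ^ t := by
          rw [hμ, show t = (t - 1) + 1 by omega, pow_succ, Nat.add_sub_cancel, inv_pow]
          field_simp
      _ ≤ q * ((q : ℝ)⁻¹) ^ U.card :=
          mul_le_mul_of_nonneg_left (pow_le_pow_of_le_one (by positivity)
            (inv_le_one_of_one_le₀ (by linarith)) hUt) hq0.le
  let T : Finset (Fin M₁) := univ.filter fun i => ∀ u ∈ U, i ≠ u.1
  refine (expect_response_le_add (fun k : Choice q n M₁ M₂ w => fun u : U => fingerprint k u)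
    V.prob V.prob_nonneg V.prob_sum (fun k y => ∀ u ∈ U, (D k y).1 ≠ u.1)
    (fun k => (colCount U P k : ℝ) ≤ n * (μ - η)) T
    (fun i k y => (hammingDist (k.1 i) y : ℝ) ≤ ρ * n) ?_).trans (add_le_add ?_ ?_)
  · intro k y hVy hbad
    by_cases hA : (colCount U P k : ℝ) ≤ n * (μ - η)
    · exact Or.inl hA
    right
    push Not at hA
    refine ⟨(D k y).1, mem_filter.2 ⟨mem_univ _, hbad⟩, ?_⟩
    have henv : y ∈ envelope fun u : U => fingerprint k u := by
      by_contra h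
      exact hVy (hV _ _ h)
    have hsum := sum_hammingDist_le _ y henv (univ.filter fun l => P (fun i => k.1 i l)
      (fun u => (k.2 u.1.1 u.1.2).1 l)) fun l hl => (mem_filter.1 hl).2
    have hZ : ((univ.filter fun l => P (fun i => k.1 i l)
        (fun u => (k.2 u.1.1 u.1.2).1 l)).card : ℝ) = colCount U P k := by
      unfold colCount
      congr!
    rw [hZ, Fintype.card_coe] at hsum
    set d : ℝ := (hammingDist (fingerprint k (D k y)) y : ℝ) with hd
    have hmin : (U.card : ℝ) * d ≤ ∑ u : U, (hammingDist (fingerprint k u) y : ℝ) := by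
      rw [← Fintype.card_coe U, ← card_univ, ← nsmul_eq_mul, ← sum_const]
      exact sum_le_sum fun u _ => Nat.cast_le.2 (hD k y u)
    have hZn : (colCount U P k : ℝ) ≤ n := by
      have : colCount U P k ≤ n := by
        unfold colCount
        exact (card_le_univ _).trans (Fintype.card_fin n).le
      exact_mod_cast this
    have hm1 : (1 : ℝ) ≤ U.card := by exact_mod_cast hU.card_pos
    have hmt : (U.card : ℝ) ≤ t := by exact_mod_cast hUt
    have hd1 : d ≤ ((t : ℝ) - 1) / t * (n - colCount U P k) := by
      rw [div_mul_eq_mul_div, le_div_iff₀ ht0]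
      have h1 : (U.card : ℝ) * d ≤ (U.card - 1) * (n - colCount U P k) := hmin.trans hsum
      have h2 : (0 : ℝ) ≤ n - colCount U P k := by linarith
      -- For m ≤ t one has (m - 1) t ≤ m (t - 1): the largest coalition is the worst case.
      have h3 : (U.card : ℝ) * (d * t) ≤ U.card * ((t - 1) * (n - colCount U P k)) := by
        nlinarith [mul_le_mul_of_nonneg_left h1 ht0.le]
      exact le_of_mul_le_mul_left h3 (by linarith)
    have hd2 : d ≤ ((t : ℝ) - 1) / t * (1 - μ) * n + η * n := by
      have h1 := mul_le_mul_of_nonneg_left hA.le hfrac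
      have h2 : ((t : ℝ) - 1) / t * (η * n) ≤ 1 * (η * n) :=
        mul_le_mul_of_nonneg_right hfrac1 (by positivity)
      linarith
    -- The decoded fingerprint lies at distance exactly `w` = ωn from the center of its group.
    have htri : (hammingDist (k.1 (D k y).1) y : ℝ) ≤ w + d := by
      have h1 := hammingDist_triangle (k.1 (D k y).1) (fingerprint k (D k y)) y
      have h2 : hammingDist (k.1 (D k y).1) (fingerprint k (D k y)) = w := by
        rw [hammingDist_eq_hammingNorm, fingerprint, neg_add_cancel_left]
        exact (k.2 _ _).2
      rw [h2] at h1
      rw [hd]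
      exact_mod_cast h1
    rw [hρ]
    linarith
  · refine (expect_colCount_le hq hw hω hwω U P hμP hη.le hη1).trans ?_
    gcongr
    linarith [(Nat.cast_nonneg n : (0 : ℝ) ≤ n)]
  · have hcenter : ∀ i ∈ T, 𝔼 k : Choice q n M₁ M₂ w, ∑ y,
        V.prob (fun u => fingerprint k u) y * ind ((hammingDist (k.1 i) y : ℝ) ≤ ρ * n) ≤
          (q : ℝ) ^ (n * (entropy q ρ - 1)) := by
      intro i hi
      refine expect_response_le (fun k : Choice q n M₁ M₂ w => k.1 i)
        (fun k r => (Function.update k.1 i r, k.2)) (by simp) (by simp)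
        (fun k : Choice q n M₁ M₂ w => fun u : U => fingerprint k u) ?_ V.prob V.prob_nonneg
        V.prob_sum (fun k y => (hammingDist (k.1 i) y : ℝ) ≤ ρ * n) _ ?_
      · intro k r
        funext u
        simp only [fingerprint]
        -- No pirate belongs to group `i`, so the coalition's view does not involve the resampled
        -- center.
        rw [Function.update_of_ne ((mem_filter.1 hi).2 u.1 u.2).symm]
      · intro k y
        simp only [Function.update_self]
        rw [Fintype.expect_eq_sum_div_card, sum_ind_eq_card, Fintype.card_fun, ZMod.card,
          Fintype.card_fin, mul_sub, mul_one, Real.rpow_sub hq0, Real.rpow_natCast, Nat.cast_pow]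
        gcongr
        exact card_ball_le hq y hρ0 hρq
    refine (sum_le_sum hcenter).trans ?_
    rw [sum_const, nsmul_eq_mul]
    have : (T.card : ℝ) ≤ M₁ := by
      exact_mod_cast (card_le_univ T).trans (Fintype.card_fin M₁).le
    gcongr

/-! ### Innocent users in the group of a pirate -/

theorem hammingDist_fingerprint {q n M₁ M₂ w : ℕ} (k : Choice q n M₁ M₂ w) (u : User M₁ M₂)
    (y : Word q n) :
    hammingDist (fingerprint k u) y = hammingDist (k.2 u.1 u.2).1 (y - k.1 u.1) := by
  rw [hammingDist_eq_hammingNorm, hammingDist_eq_hammingNorm, fingerprint]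
  congr 1
  abel

/-- The probability that the closest user is innocent but in the group of the pirate `u₀`. -/
theorem fellow_error_le {q n M₁ M₂ w : ℕ} [NeZero q] (hq : 3 ≤ q) (hw : w ≤ n)
    (D : Choice q n M₁ M₂ w → Word q n → User M₁ M₂) (U : Finset (User M₁ M₂))
    (V : Strategy q n U) (u₀ : User M₁ M₂) (A : Choice q n M₁ M₂ w → Prop) {r N : ℝ} (hN : 0 ≤ N)
    (h : ∀ k y, V.prob (fun u => fingerprint k u) y ≠ 0 → A k ∨
      ((hammingDist (fingerprint k (D k y)) y : ℝ) ≤ r ∧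
        ((univ.filter fun s : Sphere q n w =>
          (hammingDist s.1 (y - k.1 u₀.1) : ℝ) ≤ r).card : ℝ) ≤ N)) :
    𝔼 k : Choice q n M₁ M₂ w,
      ∑ y, V.prob (fun u => fingerprint k u) y * ind (D k y ∉ U ∧ (D k y).1 = u₀.1) ≤
      𝔼 k : Choice q n M₁ M₂ w, ind (A k) +
        M₂ * (N * (1 / (Fintype.card (Sphere q n w) : ℝ))) := by
  classical
  have hne := nonempty_choice (M₁ := M₁) (M₂ := M₂) hq hw
  have hneS : Nonempty (Sphere q n w) := sphere_nonempty (by omega) hw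
  let T : Finset (Fin M₂) := univ.filter fun j => (u₀.1, j) ∉ U
  -- Including `Q` in the error event makes the bound valid for every `y`: `Q` is unaffected by the
  -- resampled offset, and when it fails the event is empty.
  let Q : Word q n → Prop := fun z =>
    ((univ.filter fun s : Sphere q n w => (hammingDist s.1 z : ℝ) ≤ r).card : ℝ) ≤ N
  refine (expect_response_le_add (fun k : Choice q n M₁ M₂ w => fun u : U => fingerprint k u)
    V.prob V.prob_nonneg V.prob_sum (fun k y => D k y ∉ U ∧ (D k y).1 = u₀.1) A T
    (fun j k y => (hammingDist (k.2 u₀.1 j).1 (y - k.1 u₀.1) : ℝ) ≤ r ∧ Q (y - k.1 u₀.1))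
    ?_).trans (add_le_add le_rfl ?_)
  · rintro k y hVy ⟨hDU, hDg⟩
    refine (h k y hVy).imp_right fun ⟨h1, h2⟩ => ⟨(D k y).2, mem_filter.2 ⟨mem_univ _, ?_⟩, ?_, h2⟩
    · rw [← hDg]; exact hDU
    · rw [hammingDist_fingerprint, hDg] at h1; exact h1
  · have hfellow : ∀ j ∈ T, 𝔼 k : Choice q n M₁ M₂ w, ∑ y,
        V.prob (fun u => fingerprint k u) y *
          ind ((hammingDist (k.2 u₀.1 j).1 (y - k.1 u₀.1) : ℝ) ≤ r ∧ Q (y - k.1 u₀.1)) ≤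
          N * (1 / (Fintype.card (Sphere q n w) : ℝ)) := by
      intro j hj
      refine expect_response_le (fun k : Choice q n M₁ M₂ w => k.2 u₀.1 j)
        (fun k s => (k.1, Function.update k.2 u₀.1 (Function.update (k.2 u₀.1) j s)))
        (by simp) (by simp)
        (fun k : Choice q n M₁ M₂ w => fun u : U => fingerprint k u) ?_ V.prob V.prob_nonneg
        V.prob_sum (fun k y => (hammingDist (k.2 u₀.1 j).1 (y - k.1 u₀.1) : ℝ) ≤ r ∧
          Q (y - k.1 u₀.1)) _ ?_
      · intro k s
        funext u
        simp only [fingerprint]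
        by_cases hu : u.1.1 = u₀.1
        · have hj' : u.1.2 ≠ j := by
            rintro rfl
            refine (mem_filter.1 hj).2 ?_
            rw [← hu]
            exact u.2
          rw [hu, Function.update_self, Function.update_of_ne hj']
        · rw [Function.update_of_ne hu]
      · intro k y
        simp only [Function.update_self, ind_and]
        rw [← expect_mul, Fintype.expect_eq_sum_div_card, sum_ind_eq_card,
          ← div_eq_mul_one_div]
        by_cases hQ : Q (y - k.1 u₀.1)
        · rw [ind_of hQ, mul_one]
          gcongr
        · rw [ind_of_not hQ, mul_zero]
          positivity
    refine (sum_le_sum hfellow).trans ?_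
    rw [sum_const, nsmul_eq_mul]
    have : (T.card : ℝ) ≤ M₂ := by
      exact_mod_cast (card_le_univ T).trans (Fintype.card_fin M₂).le
    gcongr

/-- A lone pirate can only reproduce the own fingerprint, so the decoded fingerprint must coincide
with it. At most one offset achieves this. -/
theorem single_fellow_error_le {q n M₁ M₂ w : ℕ} [NeZero q] (hq : 3 ≤ q) (hw : w ≤ n)
    {D : Choice q n M₁ M₂ w → Word q n → User M₁ M₂} (hD : IsMDDecoder D)
    (u₀ : User M₁ M₂) {U : Finset (User M₁ M₂)} (hU : U = {u₀}) (V : Strategy q n U)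
    (hV : V.Admissible) :
    𝔼 k : Choice q n M₁ M₂ w,
      ∑ y, V.prob (fun u => fingerprint k u) y * ind (D k y ∉ U ∧ (D k y).1 = u₀.1) ≤
        M₂ * (1 / (Fintype.card (Sphere q n w) : ℝ)) := by
  refine (fellow_error_le hq hw D U V u₀ (fun _ => False) (r := 0) zero_le_one ?_).trans ?_
  · intro k y hVy
    have henv : y ∈ envelope fun u : U => fingerprint k u := by
      by_contra h
      exact hVy (hV _ _ h)
    have hy : y = fingerprint k u₀ := by
      funext l
      obtain ⟨u, hu⟩ := henv l
      have : u.1 = u₀ := mem_singleton.1 (hU.subset u.2)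
      rw [hu, ← this]
    right
    constructor
    · have := hD k y u₀
      rw [← hy, hammingDist_self] at this
      exact_mod_cast this
    · rw [Nat.cast_le_one, card_le_one]
      intro s hs s' hs'
      have h1 := (mem_filter.1 hs).2
      have h2 := (mem_filter.1 hs').2
      rw [← Nat.cast_zero, Nat.cast_le, Nat.le_zero, hammingDist_eq_zero] at h1 h2
      exact Subtype.ext (h1.trans h2.symm)
  · simp [ind]

/-- Coordinates where both relative letters are nonzero, or both zero, bound the relative weight of
the forgery from below and above. Where the letters coincide neither pirate is at distance, and
elsewhere exactly one is. Hence the smaller distance is at most half the disagreement, which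
accounts for 1 - 2δ. -/
theorem pair_fellow_error_le {q n M₁ M₂ w : ℕ} [NeZero q] (hq : 3 ≤ q) (hw : w ≤ n) (hn : 0 < n)
    {ω : ℝ} (hω : ω ∈ Set.Icc (0 : ℝ) 1) (hwω : (w : ℝ) = ω * n)
    {D : Choice q n M₁ M₂ w → Word q n → User M₁ M₂} (hD : IsMDDecoder D)
    {U : Finset (User M₁ M₂)} (u₀ u₁ : U) (hU : ∀ u : U, u = u₀ ∨ u = u₁) (hcard : U.card = 2)
    (V : Strategy q n U) (hV : V.Admissible) {lo hi δ η E : ℝ} (hη : 0 < η) (hη1 : η ≤ 1)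
    (hlo : lo ≤ colProb q ω U fun c d => d u₀ ≠ 0 ∧ c u₁.1.1 + d u₁ - c u₀.1.1 ≠ 0)
    (hhi : 1 - hi ≤ colProb q ω U fun c d => d u₀ = 0 ∧ c u₁.1.1 + d u₁ - c u₀.1.1 = 0)
    (hδ : 1 - 2 * δ ≤ colProb q ω U fun c d => c u₁.1.1 + d u₁ - c u₀.1.1 = d u₀)
    (hE : ∀ γ α β, PhiDomain ω γ α β → lo - η ≤ γ → γ ≤ hi + η → γ - β + α ≤ δ + η →
      phi q ω γ α β ≤ E) :
    𝔼 k : Choice q n M₁ M₂ w,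
      ∑ y, V.prob (fun u => fingerprint k u) y * ind (D k y ∉ U ∧ (D k y).1 = u₀.1.1) ≤
      3 * ((n + 1) ^ 2 * Real.exp (-(n * η ^ 2 / 4))) + M₂ * ((n + 1) ^ 2 * (q : ℝ) ^ (n * E) *
        (1 / (Fintype.card (Sphere q n w) : ℝ))) := by
  classical
  have hn' : (0 : ℝ) < n := by exact_mod_cast hn
  let P₁ : (Fin M₁ → ZMod q) → (U → ZMod q) → Prop :=
    fun c d => d u₀ ≠ 0 ∧ c u₁.1.1 + d u₁ - c u₀.1.1 ≠ 0
  let P₂ : (Fin M₁ → ZMod q) → (U → ZMod q) → Prop :=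
    fun c d => d u₀ = 0 ∧ c u₁.1.1 + d u₁ - c u₀.1.1 = 0
  let P₃ : (Fin M₁ → ZMod q) → (U → ZMod q) → Prop :=
    fun c d => c u₁.1.1 + d u₁ - c u₀.1.1 = d u₀
  refine (fellow_error_le hq hw D U V u₀
    (fun k => (colCount U P₁ k : ℝ) ≤ n * (lo - η) ∨ (colCount U P₂ k : ℝ) ≤ n * (1 - hi - η) ∨
      (colCount U P₃ k : ℝ) ≤ n * (1 - 2 * δ - η)) (r := n * (δ + η))
      (N := (n + 1) ^ 2 * (q : ℝ) ^ (n * E)) (by positivity) ?_).trans (add_le_add ?_ le_rfl)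
  · intro k y hVy
    have henv : y ∈ envelope fun u : U => fingerprint k u := by
      by_contra h
      exact hVy (hV _ _ h)
    refine or_iff_not_imp_left.2 fun hA => ?_
    push Not at hA
    obtain ⟨hA1, hA2, hA3⟩ := hA
    let d₀ : Word q n := (k.2 u₀.1.1 u₀.1.2).1
    let z : Word q n := fun l => k.1 u₁.1.1 l + (k.2 u₁.1.1 u₁.1.2).1 l - k.1 u₀.1.1 l
    have hy : ∀ l, (y - k.1 u₀.1.1) l = d₀ l ∨ (y - k.1 u₀.1.1) l = z l := by
      intro l
      obtain ⟨u, hu⟩ := henv l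
      rcases hU u with rfl | rfl
      · left; simp [hu, fingerprint, d₀]
      · right; simp [hu, fingerprint, z]
    have c1 : colCount U P₁ k ≤ hammingNorm (y - k.1 u₀.1.1) := by
      unfold colCount hammingNorm
      refine card_le_card fun l hl => ?_
      simp only [mem_filter, mem_univ, true_and] at hl ⊢
      rcases hy l with h' | h' <;> rw [h']
      · exact hl.1
      · exact hl.2
    have c2 : colCount U P₂ k + hammingNorm (y - k.1 u₀.1.1) ≤ n := by
      unfold colCount hammingNorm
      rw [← card_union_of_disjoint]
      · exact (card_le_univ _).trans (Fintype.card_fin n).le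
      · rw [disjoint_left]
        intro l h h'
        simp only [mem_filter, mem_univ, true_and] at h h'
        refine h' ?_
        rcases hy l with h'' | h'' <;> rw [h'']
        · exact h.1
        · exact h.2
    have c3 : hammingDist (fingerprint k u₀) y + hammingDist (fingerprint k u₁) y +
        colCount U P₃ k ≤ n := by
      rw [hammingDist_fingerprint]
      have e : hammingDist (fingerprint k u₁) y = hammingDist z (y - k.1 u₀.1.1) := by
        rw [hammingDist_eq_hammingNorm, hammingDist_eq_hammingNorm]
        congr 1
        funext l
        simp only [fingerprint, z, Pi.add_apply, Pi.sub_apply, Pi.neg_apply]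
        ring
      rw [e]
      unfold colCount hammingDist
      simp only [card_filter, ← sum_add_distrib]
      calc _ ≤ ∑ _l : Fin n, 1 := sum_le_sum fun l _ => ?_
        _ = n := by simp
      have h := hy l
      have hP : P₃ (fun i => k.1 i l) (fun u => (k.2 u.1.1 u.1.2).1 l) ↔ z l = d₀ l := Iff.rfl
      simp only [hP]
      change (if d₀ l ≠ (y - k.1 u₀.1.1) l then 1 else 0) + _ + _ ≤ 1
      by_cases h1 : z l = d₀ l
      · rw [h1, or_self] at h
        simp [h1, h]
      · rcases h with h | h
        · simp [h, h1]
        · simp [h, h1, Ne.symm h1]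
    have c1' : (colCount U P₁ k : ℝ) ≤ hammingNorm (y - k.1 u₀.1.1) := by exact_mod_cast c1
    have c2' : (colCount U P₂ k : ℝ) + hammingNorm (y - k.1 u₀.1.1) ≤ n := by exact_mod_cast c2
    have c3' : (hammingDist (fingerprint k u₀) y : ℝ) + hammingDist (fingerprint k u₁) y +
        colCount U P₃ k ≤ n := by exact_mod_cast c3
    have m0 : (hammingDist (fingerprint k (D k y)) y : ℝ) ≤ hammingDist (fingerprint k u₀) y := by
      exact_mod_cast hD k y u₀
    have m1 : (hammingDist (fingerprint k (D k y)) y : ℝ) ≤ hammingDist (fingerprint k u₁) y := by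
      exact_mod_cast hD k y u₁
    have hnη : 0 ≤ n * η := by positivity
    refine ⟨by linarith, card_sphere_close_le hq hn hwω hE _ (by linarith) (by linarith)⟩
  · have hb : ∀ (P : (Fin M₁ → ZMod q) → (U → ZMod q) → Prop) (μ : ℝ), μ ≤ colProb q ω U P →
        𝔼 k : Choice q n M₁ M₂ w, ind ((colCount U P k : ℝ) ≤ n * (μ - η)) ≤
          (n + 1) ^ 2 * Real.exp (-(n * η ^ 2 / 4)) := by
      intro P μ hμ
      have h := expect_colCount_le hq hw hω hwω U P hμ hη.le hη1
      rwa [hcard] at h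
    have h1 := hb P₁ lo hlo
    have h2 := hb P₂ (1 - hi) hhi
    have h3 := hb P₃ (1 - 2 * δ) hδ
    calc _ ≤ 𝔼 k : Choice q n M₁ M₂ w, (ind ((colCount U P₁ k : ℝ) ≤ n * (lo - η)) +
          (ind ((colCount U P₂ k : ℝ) ≤ n * (1 - hi - η)) +
            ind ((colCount U P₃ k : ℝ) ≤ n * (1 - 2 * δ - η)))) :=
          expect_le_expect fun k _ => (ind_or_le _ _).trans (by gcongr; exact ind_or_le _ _)
      _ ≤ _ := by
          rw [expect_add_distrib, expect_add_distrib]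
          linarith

/-- The probability that the closest user is innocent, for coalitions of at most two pirates. -/
theorem user_error_le {q n M₁ M₂ w : ℕ} [NeZero q] (hq : 3 ≤ q) (hw : w ≤ n) (hn : 0 < n)
    {ω : ℝ} (hω : ω ∈ Set.Icc (0 : ℝ) 1) (hwω : (w : ℝ) = ω * n)
    {D : Choice q n M₁ M₂ w → Word q n → User M₁ M₂} (hD : IsMDDecoder D)
    {U : Finset (User M₁ M₂)} (hU : U.Nonempty) (hU2 : U.card ≤ 2) (V : Strategy q n U)
    (hV : V.Admissible) {η E G : ℝ} (hη : 0 < η) (hη1 : η ≤ 1) (hE0 : 0 ≤ E)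
    (hE₁ : ∀ γ α β, PhiDomain ω γ α β → ω ^ 2 - η ≤ γ → γ ≤ 1 - (1 - ω) ^ 2 + η →
      γ - β + α ≤ delta1 q ω + η → phi q ω γ α β ≤ E)
    (hE₂ : ∀ γ α β, PhiDomain ω γ α β → ω * (((q : ℝ) - 1) / q) - η ≤ γ →
      γ ≤ 1 - (1 - ω) / q + η → γ - β + α ≤ delta2 q + η → phi q ω γ α β ≤ E)
    (hG : 𝔼 k : Choice q n M₁ M₂ w, ∑ y, V.prob (fun u => fingerprint k u) y *
      ind (∀ u ∈ U, (D k y).1 ≠ u.1) ≤ G) :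
    𝔼 k : Choice q n M₁ M₂ w,
      ∑ y, V.prob (fun u => fingerprint k u) y * ind (D k y ∉ U) ≤
      G + 2 * (3 * ((n + 1) ^ 2 * Real.exp (-(n * η ^ 2 / 4))) +
        M₂ * ((n + 1) ^ 2 * (q : ℝ) ^ (n * E) * ((n + 1) * (q : ℝ) ^ (-(n * entropy q ω))))) := by
  classical
  have hne := nonempty_choice (M₁ := M₁) (M₂ := M₂) hq hw
  have hq' : (3 : ℝ) ≤ q := by exact_mod_cast hq
  have hn1 : (0 : ℝ) ≤ n := Nat.cast_nonneg n
  have hS := one_div_card_sphere_le_rpow hq hw hω hwω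
  set B := 3 * (((n : ℝ) + 1) ^ 2 * Real.exp (-(n * η ^ 2 / 4))) +
    M₂ * (((n : ℝ) + 1) ^ 2 * (q : ℝ) ^ (n * E) * ((n + 1) * (q : ℝ) ^ (-(n * entropy q ω))))
    with hB
  have hB0 : 0 ≤ B := by positivity
  have hpair : 3 * (((n : ℝ) + 1) ^ 2 * Real.exp (-(n * η ^ 2 / 4))) + M₂ * ((n + 1) ^ 2 *
      (q : ℝ) ^ (n * E) * (1 / (Fintype.card (Sphere q n w) : ℝ))) ≤ B := by
    rw [hB]
    gcongr
  have hfellow : ∀ u₀ ∈ U, 𝔼 k : Choice q n M₁ M₂ w, ∑ y, V.prob (fun u => fingerprint k u) y *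
      ind (D k y ∉ U ∧ (D k y).1 = u₀.1) ≤ B := by
    intro u₀ hu₀
    have hcase : U.card = 1 ∨ U.card = 2 := by
      have := hU.card_pos
      omega
    rcases hcase with h1 | h2
    · obtain ⟨u, rfl⟩ := card_eq_one.1 h1
      rw [mem_singleton] at hu₀
      subst hu₀
      refine (single_fellow_error_le hq hw hD u₀ rfl V hV).trans (le_trans ?_ hpair)
      -- The single-pirate bound lacks this factor; since `E` is nonnegative it is at least 1 and
      -- can be inserted.
      have hone : 1 ≤ ((n : ℝ) + 1) ^ 2 * (q : ℝ) ^ (n * E) :=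
        one_le_mul_of_one_le_of_one_le (one_le_pow₀ (by linarith))
          (Real.one_le_rpow (by linarith) (by positivity))
      have h3 : 1 * (1 / (Fintype.card (Sphere q n w) : ℝ)) ≤
          ((n : ℝ) + 1) ^ 2 * (q : ℝ) ^ (n * E) * (1 / (Fintype.card (Sphere q n w) : ℝ)) :=
        mul_le_mul_of_nonneg_right hone (by positivity)
      rw [one_mul] at h3
      have h4 := mul_le_mul_of_nonneg_left h3 (Nat.cast_nonneg (α := ℝ) M₂)
      have h5 : 0 ≤ 3 * (((n : ℝ) + 1) ^ 2 * Real.exp (-(n * η ^ 2 / 4))) := by positivity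
      linarith
    · obtain ⟨u₁, hu₁, hne'⟩ := exists_mem_ne (by omega : 1 < U.card) u₀
      have hUeq : ∀ u : U, u = ⟨u₀, hu₀⟩ ∨ u = ⟨u₁, hu₁⟩ := by
        intro u
        have hsub : ({u₀, u₁} : Finset (User M₁ M₂)) ⊆ U := by
          intro v hv
          rcases mem_insert.1 hv with rfl | hv
          · exact hu₀
          · rw [mem_singleton.1 hv]; exact hu₁
        have heq := eq_of_subset_of_card_le hsub (by rw [h2, card_pair hne'.symm])
        have := heq.ge u.2
        rw [mem_insert, mem_singleton] at this
        exact this.imp (fun h => Subtype.ext h) fun h => Subtype.ext h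
      by_cases hg : u₀.1 = u₁.1
      · obtain ⟨p1, p2, p3⟩ := colProb_same_group hq ω (u₀ := (⟨u₀, hu₀⟩ : U)) (u₁ := ⟨u₁, hu₁⟩)
          (fun h => hne' (congrArg Subtype.val h).symm) hg
        refine le_trans (pair_fellow_error_le hq hw hn hω hwω hD ⟨u₀, hu₀⟩ ⟨u₁, hu₁⟩ hUeq h2 V hV
          hη hη1 p1.ge (by rw [p2]; linarith) ?_ hE₁) hpair
        rw [p3, delta1]
        linarith
      · obtain ⟨p1, p2, p3⟩ := colProb_different_group hq ω (u₀ := (⟨u₀, hu₀⟩ : U))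
          (u₁ := ⟨u₁, hu₁⟩) hg
        refine le_trans (pair_fellow_error_le hq hw hn hω hwω hD ⟨u₀, hu₀⟩ ⟨u₁, hu₁⟩ hUeq h2 V hV
          hη hη1 p1.ge (by rw [p2]; linarith) ?_ hE₂) hpair
        rw [p3, delta2]
        linarith
  -- An innocent output lies in a group without pirates or in the group of one of at most two
  -- pirates, whence the factor 2.
  have hsplit : ∀ k y, ind (D k y ∉ U) ≤ ind (∀ u ∈ U, (D k y).1 ≠ u.1) +
      ∑ u₀ ∈ U, ind (D k y ∉ U ∧ (D k y).1 = u₀.1) := by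
    intro k y
    refine le_trans (ind_mono fun h => ?_) ((ind_or_le _ _).trans
      (add_le_add le_rfl (ind_exists_le U fun u₀ => D k y ∉ U ∧ (D k y).1 = u₀.1)))
    by_cases hg : ∀ u ∈ U, (D k y).1 ≠ u.1
    · exact Or.inl hg
    · push Not at hg
      obtain ⟨u, hu, he⟩ := hg
      exact Or.inr ⟨u, hu, h, he⟩
  calc 𝔼 k : Choice q n M₁ M₂ w, ∑ y, V.prob (fun u => fingerprint k u) y * ind (D k y ∉ U)
      ≤ 𝔼 k : Choice q n M₁ M₂ w, (∑ y, V.prob (fun u => fingerprint k u) y *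
          ind (∀ u ∈ U, (D k y).1 ≠ u.1) + ∑ u₀ ∈ U, ∑ y, V.prob (fun u => fingerprint k u) y *
            ind (D k y ∉ U ∧ (D k y).1 = u₀.1)) := by
        refine expect_le_expect fun k _ => ?_
        rw [sum_comm, ← sum_add_distrib]
        refine sum_le_sum fun y _ => ?_
        rw [← mul_sum, ← mul_add]
        exact mul_le_mul_of_nonneg_left (hsplit k y) (V.prob_nonneg _ _)
    _ ≤ G + ∑ u₀ ∈ U, B := by
        rw [expect_add_distrib]
        refine add_le_add hG ?_
        rw [expect_sum_comm]
        exact sum_le_sum hfellow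
    _ ≤ G + 2 * B := by
        rw [sum_const, nsmul_eq_mul]
        have : (U.card : ℝ) ≤ 2 := by exact_mod_cast hU2
        gcongr

/-! ### Asymptotics -/

theorem tendsto_succ_pow_mul_pow (k : ℕ) {r : ℝ} (h0 : 0 < r) (h1 : r < 1) :
    Tendsto (fun n : ℕ => ((n : ℝ) + 1) ^ k * r ^ n) atTop (𝓝 0) := by
  have h := (tendsto_pow_const_mul_const_pow_of_abs_lt_one k
    (show |r| < 1 by rwa [abs_of_pos h0])).comp (tendsto_add_atTop_nat 1)
  have h2 := h.div_const r
  rw [zero_div] at h2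
  refine h2.congr fun n => ?_
  simp only [Function.comp_apply]
  push_cast
  rw [pow_succ]
  field_simp

theorem entropy_at_uniform {q : ℕ} (hq : 3 ≤ q) : entropy q (((q : ℝ) - 1) / q) = 1 := by
  have hq' : (3 : ℝ) ≤ q := by exact_mod_cast hq
  have hq0 : (q : ℝ) ≠ 0 := by linarith
  have hq1 : (q : ℝ) - 1 ≠ 0 := by linarith
  have e1 : ((q : ℝ) - 1) / q / ((q : ℝ) - 1) = (q : ℝ)⁻¹ := by field_simp
  have e2 : 1 - ((q : ℝ) - 1) / q = (q : ℝ)⁻¹ := by field_simp; ring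
  unfold entropy
  rw [e1, e2, Real.logb_inv, Real.logb_self_eq_one (by linarith)]
  field_simp
  ring

theorem continuous_entropy {q : ℕ} (hq : 3 ≤ q) : Continuous (entropy q) := by
  have : entropy q = fun x => Real.qaryEntropy q x / Real.log q :=
    funext (entropy_eq_qaryEntropy q (by omega))
  rw [this]
  exact (Real.qaryEntropy_continuous).div_const _

end TwoLevel

/-! ### Choice of the slack and proof of the theorem -/

open TwoLevel in
theorem mainTheorem4 (q t : ℕ) [NeZero q] (hq : 3 ≤ q) (ht : 2 < t) (ω R₁ R₂ : ℝ)
    (hω : ω ∈ Set.Icc (0 : ℝ) 1)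
    (hR₁ : R₁ ∈ Set.Icc (0 : ℝ) 1) (hR₂ : R₂ ∈ Set.Icc (0 : ℝ) 1)
    (hωt : ((t : ℝ) - 1) / t * (1 - 1 / (q : ℝ) ^ (t - 1)) + ω ≤ ((q : ℝ) - 1) / q)
    (hrate₁ : R₁ < 1 - TwoLevel.entropy q
      (((t : ℝ) - 1) / t * (1 - 1 / (q : ℝ) ^ (t - 1)) + ω))
    (hrate₂ : R₂ < TwoLevel.entropy q ω - max (TwoLevel.f1 q ω) (TwoLevel.f2 q ω)) :
    ∃ ε : ℕ → ℝ, Tendsto ε atTop (𝓝 0) ∧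
      ∀ (n w : ℕ) (hw : w ≤ n), (w : ℝ) = ω * n →
        ∀ D : TwoLevel.Choice q n ⌊(q : ℝ) ^ ((n : ℝ) * R₁)⌋₊ ⌊(q : ℝ) ^ ((n : ℝ) * R₂)⌋₊ w →
            TwoLevel.Word q n →
            TwoLevel.User ⌊(q : ℝ) ^ ((n : ℝ) * R₁)⌋₊ ⌊(q : ℝ) ^ ((n : ℝ) * R₂)⌋₊,
          TwoLevel.IsMDDecoder D →
            (TwoLevel.construction q n _ _ w (le_trans (by norm_num) hq) hw D).IsFingerprinting
              t 2 (ε n) := by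
  have hq' : (3 : ℝ) ≤ q := by exact_mod_cast hq
  have hq0 : (0 : ℝ) < q := by linarith
  set ρ₀ := ((t : ℝ) - 1) / t * (1 - 1 / (q : ℝ) ^ (t - 1)) + ω with hρ₀
  -- Equality would give entropy 1 and force R₁ < 0. The strict inequality leaves room for ρ₀ + η
  -- below (q-1)/q.
  have hρlt : ρ₀ < ((q : ℝ) - 1) / q := by
    refine lt_of_le_of_ne hωt fun h => ?_
    rw [h, entropy_at_uniform hq] at hrate₁
    linarith [hR₁.1]
  set F := max (f1 q ω) (f2 q ω) with hF
  obtain ⟨c, hc, hcF⟩ : ∃ c > 0, R₂ + (F + c) < entropy q ω :=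
    ⟨(entropy q ω - F - R₂) / 2, by linarith, by linarith⟩
  have hF0 : 0 ≤ F := (f1_nonneg hq ω).trans (le_max_left _ _)
  obtain ⟨η₁, hη₁, hs₁⟩ := exists_slack hq ω (ω ^ 2) (1 - (1 - ω) ^ 2) (delta1 q ω) c hc
  obtain ⟨η₂, hη₂, hs₂⟩ := exists_slack hq ω (ω * (((q : ℝ) - 1) / q)) (1 - (1 - ω) / q)
    (delta2 q) c hc
  obtain ⟨η₃, hη₃, hent⟩ : ∃ η₃ > 0, ∀ x, |x - ρ₀| < η₃ → entropy q x < 1 - R₁ := by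
    have := (continuous_entropy hq).continuousAt.eventually_lt (continuousAt_const (y := 1 - R₁))
      (x₀ := ρ₀) (by linarith)
    obtain ⟨η₃, hη₃, h⟩ := Metric.eventually_nhds_iff.1 this
    exact ⟨η₃, hη₃, fun x hx => h (by rwa [Real.dist_eq])⟩
  obtain ⟨η, hη, hη1, hle1, hle2, hle3, hle4⟩ : ∃ η > 0, η ≤ 1 ∧ η ≤ η₁ ∧ η ≤ η₂ ∧ η < η₃ ∧
      ρ₀ + η ≤ ((q : ℝ) - 1) / q := by
    have h4 : 0 < ((q : ℝ) - 1) / q - ρ₀ := by linarith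
    refine ⟨min 1 (min η₁ (min η₂ (min (η₃ / 2) (((q : ℝ) - 1) / q - ρ₀)))), by positivity,
      min_le_left _ _, ?_, ?_, ?_, ?_⟩
    · exact (min_le_right _ _).trans (min_le_left _ _)
    · exact (min_le_right _ _).trans ((min_le_right _ _).trans (min_le_left _ _))
    · refine lt_of_le_of_lt ((min_le_right _ _).trans ((min_le_right _ _).trans
        ((min_le_right _ _).trans (min_le_left _ _)))) (by linarith)
    · have := (min_le_right 1 (min η₁ (min η₂ (min (η₃ / 2) (((q : ℝ) - 1) / q - ρ₀))))).trans
        ((min_le_right _ _).trans ((min_le_right _ _).trans (min_le_right _ _)))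
      linarith
  have hρent : entropy q (ρ₀ + η) < 1 - R₁ :=
    hent _ (by rw [add_sub_cancel_left, abs_of_pos hη]; exact hle3)
  have hE₁ : ∀ γ α β, PhiDomain ω γ α β → ω ^ 2 - η ≤ γ → γ ≤ 1 - (1 - ω) ^ 2 + η →
      γ - β + α ≤ delta1 q ω + η → phi q ω γ α β ≤ F + c := fun γ α β hd h1 h2 h3 =>
    (hs₁ γ α β hd (by linarith) (by linarith) (by linarith)).trans
      (add_le_add_left (le_max_left (f1 q ω) (f2 q ω)) c)
  have hE₂ : ∀ γ α β, PhiDomain ω γ α β → ω * (((q : ℝ) - 1) / q) - η ≤ γ →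
      γ ≤ 1 - (1 - ω) / q + η → γ - β + α ≤ delta2 q + η → phi q ω γ α β ≤ F + c :=
    fun γ α β hd h1 h2 h3 => (hs₂ γ α β hd (by linarith) (by linarith) (by linarith)).trans
      (add_le_add_left (le_max_right (f1 q ω) (f2 q ω)) c)
  let G : ℕ → ℝ := fun n => ((n : ℝ) + 1) ^ t * Real.exp (-(n * η ^ 2 / 4)) +
    (q : ℝ) ^ ((n : ℝ) * R₁) * (q : ℝ) ^ (n * (entropy q (ρ₀ + η) - 1))
  let B : ℕ → ℝ := fun n => 3 * (((n : ℝ) + 1) ^ 2 * Real.exp (-(n * η ^ 2 / 4))) +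
    (q : ℝ) ^ ((n : ℝ) * R₂) * (((n : ℝ) + 1) ^ 2 * (q : ℝ) ^ (n * (F + c)) *
      ((n + 1) * (q : ℝ) ^ (-(n * entropy q ω))))
  have hexp : ∀ k, Tendsto (fun n : ℕ => ((n : ℝ) + 1) ^ k * Real.exp (-(n * η ^ 2 / 4))) atTop
      (𝓝 0) := by
    intro k
    refine (tendsto_succ_pow_mul_pow k (Real.exp_pos (-(η ^ 2 / 4)))
      (Real.exp_lt_one_iff.2 (neg_lt_zero.2 (by positivity)))).congr fun n => ?_
    rw [← Real.exp_nat_mul]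
    congr 2
    ring
  have hrpow : ∀ (k : ℕ) (a : ℝ), a < 0 →
      Tendsto (fun n : ℕ => ((n : ℝ) + 1) ^ k * (q : ℝ) ^ (n * a)) atTop (𝓝 0) := by
    intro k a ha
    refine (tendsto_succ_pow_mul_pow k (Real.rpow_pos_of_pos hq0 a)
      (Real.rpow_lt_one_of_one_lt_of_neg (by linarith) ha)).congr fun n => ?_
    rw [mul_comm (n : ℝ) a, Real.rpow_mul hq0.le, Real.rpow_natCast]
  have hG : Tendsto G atTop (𝓝 0) := by
    have h := (hexp t).add (hrpow 0 (R₁ + (entropy q (ρ₀ + η) - 1)) (by linarith))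
    rw [add_zero] at h
    refine h.congr fun n => ?_
    simp only [G]
    rw [← Real.rpow_add hq0, ← mul_add, pow_zero, one_mul]
  have hB : Tendsto B atTop (𝓝 0) := by
    -- The power 3 combines (n + 1)² joint types with the factor n + 1 from the sphere size.
    have h := ((hexp 2).const_mul 3).add (hrpow 3 (R₂ + (F + c) - entropy q ω) (by linarith))
    rw [mul_zero, add_zero] at h
    refine h.congr fun n => ?_
    simp only [B]
    rw [show (n : ℝ) * (R₂ + (F + c) - entropy q ω) = n * R₂ + n * (F + c) + -(n * entropy q ω) by
      ring, Real.rpow_add hq0, Real.rpow_add hq0]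
    ring
  -- At length 0 every word is vacuously in the envelope, even for the empty coalition, so the
  -- trivial bound 1 is used there.
  refine ⟨fun n => if n = 0 then 1 else G n + 2 * B n, ?_, ?_⟩
  · have h := hG.add (hB.const_mul 2)
    rw [mul_zero, add_zero] at h
    refine h.congr' ?_
    filter_upwards [eventually_ne_atTop 0] with n hn
    rw [if_neg hn]
  intro n w hw hwω D hD
  have hne := nonempty_choice (M₁ := ⌊(q : ℝ) ^ ((n : ℝ) * R₁)⌋₊)
    (M₂ := ⌊(q : ℝ) ^ ((n : ℝ) * R₂)⌋₊) hq hw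
  rcases Nat.eq_zero_or_pos n with hn | hn
  · simp only [hn, if_true]
    refine ⟨fun U _ V _ => ?_, fun U _ V _ => ?_⟩
    · rw [e₂_construction]
      exact expect_response_le_one _ _ V.prob_nonneg V.prob_sum _
    · rw [e₁_construction]
      exact expect_response_le_one _ _ V.prob_nonneg V.prob_sum _
  simp only [hn.ne', if_false]
  -- For n > 0 the empty coalition has an empty envelope, hence no admissible strategy of total mass
  -- 1.
  have hUne : ∀ (U : Finset (User ⌊(q : ℝ) ^ ((n : ℝ) * R₁)⌋₊ ⌊(q : ℝ) ^ ((n : ℝ) * R₂)⌋₊))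
      (V : Strategy q n U), V.Admissible → U.Nonempty := by
    intro U V hV
    by_contra h
    rw [Finset.not_nonempty_iff_eq_empty] at h
    have h1 := V.prob_sum 0
    rw [Finset.sum_eq_zero] at h1
    · exact zero_ne_one h1
    · intro y _
      refine hV _ _ fun hy => ?_
      obtain ⟨u, -⟩ := hy ⟨0, hn⟩
      exact Finset.notMem_empty _ (h.subset u.2)
  have hM : ∀ R : ℝ, ((⌊(q : ℝ) ^ ((n : ℝ) * R)⌋₊ : ℕ) : ℝ) ≤ (q : ℝ) ^ ((n : ℝ) * R) :=
    fun R => Nat.floor_le (by positivity)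
  have hgroup : ∀ (U : Finset (User ⌊(q : ℝ) ^ ((n : ℝ) * R₁)⌋₊ ⌊(q : ℝ) ^ ((n : ℝ) * R₂)⌋₊))
      (V : Strategy q n U), V.Admissible → U.card ≤ t → _ ≤ G n := fun U V hV hUt =>
    (group_error_le hq ht hw hω hwω hD (hUne U V hV) hUt V hV hη hη1 rfl hle4).trans
      (add_le_add le_rfl (mul_le_mul_of_nonneg_right (hM R₁) (by positivity)))
  refine ⟨fun U hU V hV => ?_, fun U hU V hV => ?_⟩
  · rw [e₂_construction]
    refine (user_error_le hq hw hn hω hwω hD (hUne U V hV) hU V hV hη hη1 (by positivity) hE₁ hE₂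
      (hgroup U V hV (by omega))).trans ?_
    refine add_le_add le_rfl (mul_le_mul_of_nonneg_left (add_le_add le_rfl
      (mul_le_mul_of_nonneg_right (hM R₂) (by positivity))) (by norm_num))
  · rw [e₁_construction]
    refine (hgroup U V hV hU).trans ?_
    have : 0 ≤ B n := by positivity
    linarith
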